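/- Let $\mathcal G=(V,E)$ be a finite, simple, undirected, connected graph with adjacency matrix $\mathcal A$, degree matrix $\mathcal D$, Laplacian $L=\mathcal D-\mathcal A$ and random-walk matrix $\mathcal W=\mathcal D^{-1}\mathcal A$. Let $\omega^\star$ be the second largest (not in absolute value) eigenvalue of $\mathcal W$, let $\Delta=d_{\max}/d_{\min}$ be the ratio of the maximum and minimum degrees, and let the conductance be $$\Phi=\min_{\emptyset\ne S\subsetneq V}\frac{|E(S,V\setminus S)|}{\min\{\sum_{i\in S}d_i,\ \sum_{i\in V\setminus S}d_i\}}.$$ Gradient descent and ADMM for minimizing $\tfrac12\sum_{(i,j)\in E}(z_i-z_j)^2$ are the linear iterations $\boldsymbol z^{t+1}=T_G\boldsymbol z^t$ and $\boldsymbol n^{t+1}=T_A\boldsymbol n^t$ with $$T_G=I-\alpha L,\qquad T_A=I-\gamma(A+B-2BA),\qquad A=(I+\rho^{-1}Q)^{-1},\qquad B=S(S^TS)^{-1}S^T.$$ Here $\alpha>0$, $\rho>0$ and $\gamma\in(0,2)$ are parameters; $T_A$, $Q$ and the rows of $S$ are indexed by the pairs $(e,i)$ with $e\in E$ and $i\in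 e$; $S_{(e,i),k}=1$ if $i=k$ and $0$ otherwise; and $Q$ is block diagonal with one block $\left(\begin{smallmatrix}1&-1\\-1&1\end{smallmatrix}\right)$ per edge. The asymptotic convergence rate of $\boldsymbol\xi^{t+1}=T\boldsymbol\xi^t$, when all its orbits converge, with limit $\boldsymbol\xi^\star=\boldsymbol\xi^\star(\boldsymbol\xi^0)$, is $\tau=\lim_{t\to\infty}\big(\max_{\|\boldsymbol\xi^0\|\le1}\|\boldsymbol\xi^t-\boldsymbol\xi^\star\|\big)^{1/t}$. Let $\tau_G^\star$ and $\tau_A^\star$ denote the minimal rates of gradient descent (over $\alpha$) and of ADMM (over $\gamma,\rho$). **Theorem.** There are a function $\delta\mapsto C(\delta)>0$ on $(0,1]$ and an absolute constant $K$ with $|C(\delta)-1|\le K\sqrt{\delta}$ for all $\delta\in(0,1]$ (so that $C(\delta)=1-O(\sqrt\delta)$), such that the following holds for every graph $\mathcal G$ as above that has a cycle of even length and conductance $\Phi\le 1/2$. One has $0<1-\omega^\star\le1$; the minimal rates $\tau_G^\star$ and $\tau_A^\star$ are attained and satisfy $$\tau_G^\star=\min_{\alpha>0}|\lambda_2(T_G)|,\qquad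 \tau_A^\star=\min_{\gamma\in(0,2),\,\rho>0}|\lambda_2(T_A)|,$$ where $|\lambda_2(T)|$ is the second largest absolute value of an eigenvalue of $T$ (counted with algebraic multiplicity); and, with $C=C(1-\omega^\star)$, $$C\,(1-\tau_G^\star)\ \le\ (1-\tau_A^\star)^2\ \le\ 2\,\Delta\,C\,(1-\tau_G^\star).$$ -/

import Mathlib

open Filter Topology

/-! ### Spectral quantities of square real matrices -/

/-- The real eigenvalues of `M`, with algebraic multiplicity, in decreasing order. -/
noncomputable def eigenvaluesDesc {ι : Type*} [Fintype ι] [DecidableEq ι]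
    (M : Matrix ι ι ℝ) : List ℝ :=
  M.charpoly.roots.sort (· ≥ ·)

/-- The absolute values of all complex eigenvalues of the real matrix `M`, with algebraic
multiplicity, in decreasing order: `|λ₁(M)| ≥ |λ₂(M)| ≥ ...`. -/
noncomputable def eigenvalueAbsDesc {ι : Type*} [Fintype ι] [DecidableEq ι]
    (M : Matrix ι ι ℝ) : List ℝ :=
  ((M.map (algebraMap ℝ ℂ)).charpoly.roots.map (fun z : ℂ => ‖z‖)).sort (· ≥ ·)

/-- `|λ₂(M)|`, the second entry of `|λ₁(M)| ≥ |λ₂(M)| ≥ ...` (default `0` in size at most one). -/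
noncomputable def absLambdaTwo {ι : Type*} [Fintype ι] [DecidableEq ι]
    (M : Matrix ι ι ℝ) : ℝ :=
  (eigenvalueAbsDesc M).getD 1 0

/-! ### Asymptotic convergence rate of a linear iteration -/

/-- `τ` is the asymptotic convergence rate of the iteration `ξᵗ⁺¹ = T ξᵗ`: from every start `ξ⁰`
the iterates `ξᵗ = Tᵗ ξ⁰` converge to some `ξ*(ξ⁰)`, and the worst error over the Euclidean unit
ball satisfies `(max_{‖ξ⁰‖ ≤ 1} ‖ξᵗ - ξ*‖) ^ (1 / t) → τ`. This is the exponential form of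
`log τ = lim_t max_{‖ξ⁰‖ ≤ 1} t⁻¹ log ‖ξᵗ - ξ*‖`, in which `τ = 0` is allowed. -/
def IsConvergenceRate {ι : Type*} [Fintype ι] [DecidableEq ι]
    (T : Matrix ι ι ℝ) (τ : ℝ) : Prop :=
  ∃ limit : EuclideanSpace ℝ ι → EuclideanSpace ℝ ι,
    (∀ ξ : EuclideanSpace ℝ ι,
      Tendsto (fun t : ℕ => Matrix.toEuclideanLin (T ^ t) ξ) atTop (𝓝 (limit ξ))) ∧
    Tendsto
      (fun t : ℕ =>
        (⨆ ξ : Metric.closedBall (0 : EuclideanSpace ℝ ι) 1,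
          ‖Matrix.toEuclideanLin (T ^ t) (ξ : EuclideanSpace ℝ ι) - limit ξ‖) ^ (1 / (t : ℝ)))
      atTop (𝓝 τ)

namespace SimpleGraph

variable {V : Type*} [Fintype V] [DecidableEq V] (G : SimpleGraph V) [DecidableRel G.Adj]

/-- The graph has a (simple) cycle of even length. -/
def HasEvenCycle {V : Type*} (G : SimpleGraph V) : Prop :=
  ∃ (v : V) (c : G.Walk v v), c.IsCycle ∧ Even c.length

/-- The volume of a set of vertices: the sum of the degrees. -/
def vol (s : Finset V) : ℕ := ∑ i ∈ s, G.degree i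

/-- The conductance `Φ`: the minimum over all proper nonempty sets `s` of vertices of the number of
edges leaving `s`, divided by the smaller of the volumes of `s` and of its complement. -/
noncomputable def conductance : ℝ :=
  ⨅ s : {s : Finset V // s.Nonempty ∧ sᶜ.Nonempty},
    ((G.interedges s.1 s.1ᶜ).card : ℝ) / (min (G.vol s.1) (G.vol s.1ᶜ) : ℕ)

/-- The transition matrix `𝒲 = 𝒟⁻¹ 𝒜` of the simple random walk. -/
noncomputable def walkMatrix : Matrix V V ℝ := (G.degMatrix ℝ)⁻¹ * G.adjMatrix ℝ

/-- `ω*`, the second largest (not in absolute value) eigenvalue of the transition matrix. -/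
noncomputable def omegaStar : ℝ := (eigenvaluesDesc G.walkMatrix).getD 1 0

/-- `Δ = d_max / d_min`. -/
noncomputable def degreeRatio : ℝ := (G.maxDegree : ℝ) / G.minDegree

/-! ### Gradient descent and ADMM for `min ½ ∑_{(i,j) ∈ E} (z_i - z_j)²` -/

/-- The gradient descent matrix `T_G = I - α L`. -/
def gdMatrix (α : ℝ) : Matrix V V ℝ := 1 - α • G.lapMatrix ℝ

/-- The matrix `S`, with rows indexed by the extended edges `(e, i)`, `i ∈ e`: the extended edge
`(e, i)` is the dart `d` with `d.edge = e` and `d.fst = i`. The row of `(e, i)` is the indicator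
of `i`. -/
def admmS : Matrix G.Dart V ℝ := Matrix.of fun d k => if d.fst = k then 1 else 0

/-- The block diagonal matrix `Q`, with one block `!![1, -1; -1, 1]` per edge. -/
def admmQ : Matrix G.Dart G.Dart ℝ :=
  Matrix.of fun d d' => if d.edge = d'.edge then (if d = d' then 1 else -1) else 0

/-- `A = (I + ρ⁻¹ Q)⁻¹`. -/
noncomputable def admmA (ρ : ℝ) : Matrix G.Dart G.Dart ℝ := (1 + ρ⁻¹ • G.admmQ)⁻¹

/-- `B = S (Sᵀ S)⁻¹ Sᵀ`. -/
noncomputable def admmB : Matrix G.Dart G.Dart ℝ :=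
  G.admmS * (G.admmS.transpose * G.admmS)⁻¹ * G.admmS.transpose

/-- The matrix `T_A = I - γ (A + B - 2 B A)` of the distributed over-relaxed ADMM. -/
noncomputable def admmMatrix (γ ρ : ℝ) : Matrix G.Dart G.Dart ℝ :=
  1 - γ • (G.admmA ρ + G.admmB - (2 : ℝ) • (G.admmB * G.admmA ρ))

/-- `τ` is the optimal convergence rate of gradient descent: the minimum over the step sizes
`α > 0` of the asymptotic convergence rate, and also `min_α |λ₂(T_G)|`. -/
def IsOptimalGDRate (τ : ℝ) : Prop :=
  IsLeast {r : ℝ | ∃ α : ℝ, 0 < α ∧ IsConvergenceRate (G.gdMatrix α) r} τ ∧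
  IsLeast {r : ℝ | ∃ α : ℝ, 0 < α ∧ r = absLambdaTwo (G.gdMatrix α)} τ

/-- `τ` is the optimal convergence rate of ADMM: the minimum over the relaxation parameters
`γ ∈ (0, 2)` and the penalty parameters `ρ > 0` of the asymptotic convergence rate, and also
`min_{γ, ρ} |λ₂(T_A)|`. -/
def IsOptimalADMMRate (τ : ℝ) : Prop :=
  IsLeast {r : ℝ | ∃ γ ρ : ℝ, 0 < γ ∧ γ < 2 ∧ 0 < ρ ∧
    IsConvergenceRate (G.admmMatrix γ ρ) r} τ ∧
  IsLeast {r : ℝ | ∃ γ ρ : ℝ, 0 < γ ∧ γ < 2 ∧ 0 < ρ ∧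
    r = absLambdaTwo (G.admmMatrix γ ρ)} τ

end SimpleGraph

/-! Both optimal rates can be computed exactly; the comparison is then elementary. For gradient
descent, with `l` and `m` the extreme nonzero Laplacian eigenvalues, the best step balances `1 - α *
l` against `α * m - 1`, so the rate is `(m - l) / (m + l)` (`Connected.isOptimalGDRate`).

For ADMM, let F reverse darts, let B average over darts with a common tail, and let `p = ρ / 2`.
Then the matrix is an affine function of `(2B - 1)(F + p)`. Averaging an eigenvector at the vertices
gives a random-walk eigenvector, so apart from `1 ± p` and `-1 - p` every eigenvalue `u` solves `u ^
2 - 2 * ω * u + 1 - p ^ 2 = 0` for a walk eigenvalue `ω` (`Connected.isEigval_dartOp_cases`). An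
even cycle carries an alternating vector with `u = -1 - p`, that is, the ADMM eigenvalue `1 - γ`.
The optimum makes the roots for `ω*` coincide, `p = s = √(1 - ω* ^ 2)`, and then chooses `γ` so that
`γ - 1` equals the eigenvalue coming from `ω*`. This gives the rate `(1 + k) / (3 - k)` with `k = ω*
/ (1 + s)` (`Connected.isOptimalADMMRate`). The bound on the conductance enters through the easy
half of Cheeger's inequality, which gives `0 ≤ ω*`.

Finally, with `δ = 1 - ω*`, one has `(1 - τA) ^ 2 = 2 * δ * C / (1 + δ)` and `1 - τG = 2 * l / (m +
l)`; the bounds `d_min * δ ≤ l ≤ d_max * δ` and `d_max ≤ m ≤ 2 * d_max` give both inequalities. -/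

/-! ### Eigenvalues and complexification. -/

section Eigenvalues

open Matrix

variable {ι : Type*} [Fintype ι]

/-- `μ` is an eigenvalue of the square matrix `M`. -/
def Matrix.IsEigval {K : Type*} [Field K] (M : Matrix ι ι K) (μ : K) : Prop :=
  ∃ x : ι → K, x ≠ 0 ∧ M *ᵥ x = μ • x

lemma Matrix.isEigval_iff_mem_roots [DecidableEq ι] {K : Type*} [Field K] (M : Matrix ι ι K)
    (μ : K) :
    M.IsEigval μ ↔ μ ∈ M.charpoly.roots := by
  rw [Polynomial.mem_roots M.charpoly_monic.ne_zero, Polynomial.IsRoot, Matrix.eval_charpoly,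
    ← Matrix.exists_mulVec_eq_zero_iff]
  refine exists_congr fun x => and_congr_right fun _ => ?_
  rw [Matrix.sub_mulVec, sub_eq_zero, Matrix.scalar_apply, ← Matrix.smul_one_eq_diagonal,
    Matrix.smul_mulVec, Matrix.one_mulVec, eq_comm]

/-- The complexification of a real matrix. -/
noncomputable abbrev Matrix.toComplex (M : Matrix ι ι ℝ) : Matrix ι ι ℂ := M.map (algebraMap ℝ ℂ)

lemma Matrix.toComplex_mulVec_re (M : Matrix ι ι ℝ) (x : ι → ℂ) :
    (fun i => ((M.toComplex *ᵥ x) i).re) = M *ᵥ fun i => (x i).re := by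
  ext i
  simp [Matrix.mulVec, dotProduct]

lemma Matrix.toComplex_mulVec_im (M : Matrix ι ι ℝ) (x : ι → ℂ) :
    (fun i => ((M.toComplex *ᵥ x) i).im) = M *ᵥ fun i => (x i).im := by
  ext i
  simp [Matrix.mulVec, dotProduct]

lemma Matrix.toComplex_mulVec_ofReal (M : Matrix ι ι ℝ) (x : ι → ℝ) :
    M.toComplex *ᵥ (fun i => (x i : ℂ)) = fun i => ((M *ᵥ x) i : ℂ) := by
  ext i
  simp [Matrix.mulVec, dotProduct]

lemma Matrix.IsEigval.toComplex {M : Matrix ι ι ℝ} {μ : ℝ} (h : M.IsEigval μ) :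
    M.toComplex.IsEigval (μ : ℂ) := by
  obtain ⟨x, hx, hM⟩ := h
  refine ⟨fun i => (x i : ℂ), fun h0 => hx ?_, ?_⟩
  · ext i
    simpa using congrFun h0 i
  · rw [Matrix.toComplex_mulVec_ofReal, hM]
    ext i
    simp

end Eigenvalues

/-! ### Second entries of decreasing lists. -/

section SortedLists

/-- Only one of the two elements can be spent on the head of the list, so the other lies in the
tail, where the second entry is the largest. -/
lemma List.min_le_getD_one_of_le {l : List ℝ} (hl : l.Pairwise (· ≥ ·)) {a b : ℝ}
    (h : ({a, b} : Multiset ℝ) ≤ (l : Multiset ℝ)) : min a b ≤ l.getD 1 0 := by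
  match l, hl, h with
  | [], _, h => simpa using Multiset.card_le_card h
  | [x], _, h => simpa using Multiset.card_le_card h
  | x :: y :: t, hl, h =>
    have hy : ∀ z ∈ y :: t, z ≤ y := by
      intro z hz
      rcases List.mem_cons.1 hz with rfl | hz
      · exact le_rfl
      · exact (List.pairwise_cons.1 (List.pairwise_cons.1 hl).2).1 z hz
    have key : a ∈ y :: t ∨ b ∈ y :: t := by
      by_cases hax : a = x
      · right
        subst hax
        have h' : (a ::ₘ {b} : Multiset ℝ) ≤ a ::ₘ ((y :: t : List ℝ) : Multiset ℝ) := h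
        rw [Multiset.cons_le_cons_iff, Multiset.singleton_le] at h'
        simpa using h'
      · left
        have : a ∈ ((x :: y :: t : List ℝ) : Multiset ℝ) := Multiset.mem_of_le h (by simp)
        simpa [hax] using this
    show min a b ≤ y
    rcases key with h | h
    · exact (min_le_left _ _).trans (hy _ h)
    · exact (min_le_right _ _).trans (hy _ h)

lemma Multiset.sort_getD_one {m : Multiset ℝ} {a b : ℝ} (hb : b ∈ m) (hm : ∀ x ∈ m, x ≤ b)
    (hba : b ≤ a) : ((a ::ₘ m).sort (· ≥ ·)).getD 1 0 = b := by
  classical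
  rw [Multiset.sort_cons _ _ _ (fun x hx => (hm x hx).trans hba), ← Multiset.cons_erase hb,
    Multiset.sort_cons _ _ _ (fun x hx => hm x (Multiset.mem_of_mem_erase hx))]
  simp

end SortedLists

/-! ### Matrices for which 1 is a simple eigenvalue with constant eigenvector. -/

section FixesConst

open Matrix

variable {ι : Type*} [Fintype ι]

/-- The fixed vectors of `T` are the constant vectors, and `φ` is a left fixed vector which is not
orthogonal to the constants. -/
structure Matrix.FixesConst (T : Matrix ι ι ℝ) (φ : ι → ℝ) : Prop where
  right : T *ᵥ 1 = 1
  left : φ ᵥ* T = φ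
  ne : φ ⬝ᵥ 1 ≠ 0
  const : ∀ x : ι → ℝ, T *ᵥ x = x → ∃ c : ℝ, x = c • (1 : ι → ℝ)

namespace Matrix.FixesConst

variable {T : Matrix ι ι ℝ} {φ : ι → ℝ} (h : T.FixesConst φ)
include h

lemma one_ne_zero : (1 : ι → ℝ) ≠ 0 := fun h0 => h.ne (by rw [h0]; simp)

lemma const_complex {x : ι → ℂ} (hx : T.toComplex *ᵥ x = x) : ∃ c : ℂ, x = fun _ => c := by
  obtain ⟨a, ha⟩ := h.const (fun i => (x i).re) (by rw [← Matrix.toComplex_mulVec_re, hx])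
  obtain ⟨b, hb⟩ := h.const (fun i => (x i).im) (by rw [← Matrix.toComplex_mulVec_im, hx])
  refine ⟨⟨a, b⟩, ?_⟩
  ext i
  exact Complex.ext (by simpa using congrFun ha i) (by simpa using congrFun hb i)

lemma isEigval_one : T.IsEigval 1 := ⟨1, h.one_ne_zero, by rw [h.right, one_smul]⟩

lemma one_mem_roots [DecidableEq ι] : (1 : ℂ) ∈ T.toComplex.charpoly.roots := by
  have := (isEigval_iff_mem_roots _ _).1 h.isEigval_one.toComplex
  rwa [Complex.ofReal_one] at this

/-- There is no Jordan block at 1: if `(T - 1) x` is a constant `c`, pairing with the left fixed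
vector `φ` gives `c * (φ ⬝ᵥ 1) = 0`, so `x` is already fixed. Hence the generalized eigenspace
consists of the constants. -/
lemma count_roots [DecidableEq ι] : T.charpoly.roots.count 1 = 1 := by
  rw [Polynomial.count_roots, ← Matrix.charpoly_toLin', ← LinearMap.finrank_maxGenEigenspace_eq]
  have key : ∀ (k : ℕ) (x : ι → ℝ), ((Matrix.toLin' T - (1 : ℝ) • 1) ^ k) x = 0 →
      ∃ c : ℝ, x = c • (1 : ι → ℝ) := by
    intro k
    induction k with
    | zero => exact fun x hx => ⟨0, by simpa using hx⟩
    | succ k ih =>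
      intro x hx
      rw [pow_succ, Module.End.mul_apply] at hx
      obtain ⟨c, hc⟩ := ih _ hx
      have hc' : T *ᵥ x - x = c • (1 : ι → ℝ) := by simpa using hc
      have h1 : φ ⬝ᵥ (T *ᵥ x - x) = 0 := by
        rw [dotProduct_sub, dotProduct_mulVec, h.left, sub_self]
      rw [hc', dotProduct_smul, smul_eq_mul] at h1
      rw [(mul_eq_zero.1 h1).resolve_right h.ne, zero_smul, sub_eq_zero] at hc'
      exact h.const x hc'
  have : Module.End.maxGenEigenspace (Matrix.toLin' T) 1 = Submodule.span ℝ {(1 : ι → ℝ)} := by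
    ext x
    rw [Module.End.mem_maxGenEigenspace, Submodule.mem_span_singleton]
    constructor
    · rintro ⟨k, hk⟩
      obtain ⟨c, hc⟩ := key k x hk
      exact ⟨c, hc.symm⟩
    · rintro ⟨c, rfl⟩
      exact ⟨1, by simp [h.right]⟩
  rw [this, finrank_span_singleton h.one_ne_zero]

/-- The minimum with 1 is needed because, when `‖μ‖ > 1`, the eigenvalue 1 itself may be the second
largest in modulus. -/
lemma min_le_absLambdaTwo [DecidableEq ι] {μ : ℂ} (hμ : T.toComplex.IsEigval μ) (hμ1 : μ ≠ 1) :
    min 1 ‖μ‖ ≤ absLambdaTwo T := by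
  refine List.min_le_getD_one_of_le (Multiset.pairwise_sort _ _) ?_
  rw [Multiset.sort_eq]
  have h1 := h.one_mem_roots
  have h2 := (isEigval_iff_mem_roots _ _).1 hμ
  have : ({1, μ} : Multiset ℂ) ≤ T.toComplex.charpoly.roots := by
    rw [Multiset.le_iff_subset (by simpa using hμ1.symm)]
    intro z hz
    rcases (by simpa using hz : z = 1 ∨ z = μ) with rfl | rfl
    exacts [h1, h2]
  have h3 := Multiset.map_le_map (f := fun z : ℂ => ‖z‖) this
  rwa [show Multiset.map (fun z : ℂ => ‖z‖) {1, μ} = {1, ‖μ‖} by simp] at h3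

/-- Since 1 is a simple root, erasing one copy of it leaves only eigenvalues to which the bound `τ ≤
1` applies. -/
lemma absLambdaTwo_eq [DecidableEq ι] {τ : ℝ} (hle : ∀ μ : ℂ, T.toComplex.IsEigval μ → μ ≠ 1 → ‖μ‖ ≤ τ)
    (hex : ∃ μ : ℂ, T.toComplex.IsEigval μ ∧ μ ≠ 1 ∧ ‖μ‖ = τ) (hτ : τ ≤ 1) :
    absLambdaTwo T = τ := by
  classical
  set R := T.toComplex.charpoly.roots with hR
  have h1 : (1 : ℂ) ∈ R := h.one_mem_roots
  have hc : R.count 1 = 1 := by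
    have := h.count_roots
    rw [Polynomial.count_roots,
      Polynomial.eq_rootMultiplicity_map (algebraMap ℝ ℂ).injective] at this
    rw [hR, Polynomial.count_roots, Matrix.toComplex, Matrix.charpoly_map]
    simpa using this
  have hn : (1 : ℂ) ∉ R.erase 1 := by
    rw [← Multiset.count_eq_zero, Multiset.count_erase_self, hc]
  rw [absLambdaTwo, eigenvalueAbsDesc, ← hR, ← Multiset.cons_erase h1, Multiset.map_cons, norm_one]
  refine Multiset.sort_getD_one ?_ ?_ hτ
  · obtain ⟨μ, hμ, hμ1, rfl⟩ := hex
    refine Multiset.mem_map_of_mem _ ?_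
    rw [Multiset.mem_erase_of_ne hμ1]
    exact (isEigval_iff_mem_roots _ _).1 hμ
  · intro x hx
    obtain ⟨z, hz, rfl⟩ := Multiset.mem_map.1 hx
    exact hle z ((isEigval_iff_mem_roots _ _).2 (Multiset.mem_of_mem_erase hz))
      (fun hz1 => hn (hz1 ▸ hz))

end Matrix.FixesConst

end FixesConst

/-! ### The convergence rate as the spectral radius away from 1. -/

section ConvergenceRate

open Matrix

attribute [local instance] Matrix.linftyOpNormedRing Matrix.linftyOpNormedAlgebra

variable {ι : Type*} [Fintype ι] [DecidableEq ι]

lemma Matrix.sum_abs_le_norm_toComplex (M : Matrix ι ι ℝ) (i : ι) :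
    ∑ j, |M i j| ≤ ‖M.toComplex‖ := by
  rw [Matrix.linfty_opNorm_def]
  have h := Finset.le_sup (f := fun i => ∑ j, ‖M.toComplex i j‖₊) (Finset.mem_univ i)
  have h' : ((∑ j, ‖M.toComplex i j‖₊ : NNReal) : ℝ) = ∑ j, |M i j| := by
    simp
  rw [← h']
  exact_mod_cast h

lemma Matrix.norm_toComplex_le (M : Matrix ι ι ℝ) {c : ℝ} (hc : 0 ≤ c)
    (h : ∀ i j, |M i j| ≤ c) : ‖M.toComplex‖ ≤ Fintype.card ι * c := by
  lift c to NNReal using hc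
  rw [Matrix.linfty_opNorm_def]
  have : (Finset.univ.sup fun i => ∑ j, ‖M.toComplex i j‖₊) ≤ Fintype.card ι * c := by
    refine Finset.sup_le fun i _ => ?_
    refine (Finset.sum_le_card_nsmul _ _ c fun j _ => ?_).trans (by simp)
    rw [← NNReal.coe_le_coe]
    simpa using h i j
  exact_mod_cast this

/-- With `Matrix.norm_toComplex_le_iSup` this shows that the worst error over the Euclidean ball and
the row-sum norm agree up to a factor of the dimension, which allows the rate to be read off from
Gelfand's formula. -/
lemma Matrix.norm_toEuclideanLin_le (M : Matrix ι ι ℝ) {ξ : EuclideanSpace ℝ ι} (hξ : ‖ξ‖ ≤ 1) :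
    ‖Matrix.toEuclideanLin M ξ‖ ≤ Fintype.card ι * ‖M.toComplex‖ := by
  have hcoord : ∀ i, ‖Matrix.toEuclideanLin M ξ i‖ ≤ ‖M.toComplex‖ := by
    intro i
    refine le_trans ?_ (M.sum_abs_le_norm_toComplex i)
    rw [Matrix.toLpLin_apply]
    refine (norm_sum_le _ _).trans (Finset.sum_le_sum fun j _ => ?_)
    rw [norm_mul, Real.norm_eq_abs]
    exact mul_le_of_le_one_right (abs_nonneg _) ((PiLp.norm_apply_le ξ j).trans hξ)
  rw [EuclideanSpace.norm_eq]
  refine Real.sqrt_le_iff.2 ⟨by positivity, ?_⟩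
  have h1 : ∑ i, ‖Matrix.toEuclideanLin M ξ i‖ ^ 2 ≤ Fintype.card ι * ‖M.toComplex‖ ^ 2 := by
    refine (Finset.sum_le_card_nsmul _ _ (‖M.toComplex‖ ^ 2) fun i _ => ?_).trans (by simp)
    exact pow_le_pow_left₀ (norm_nonneg _) (hcoord i) 2
  refine h1.trans ?_
  rw [mul_pow]
  gcongr
  exact_mod_cast Nat.le_self_pow two_ne_zero _

lemma Matrix.bddAbove_norm_toEuclideanLin (M : Matrix ι ι ℝ) :
    BddAbove (Set.range fun ξ : Metric.closedBall (0 : EuclideanSpace ℝ ι) 1 =>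
      ‖Matrix.toEuclideanLin M ξ‖) := by
  refine ⟨Fintype.card ι * ‖M.toComplex‖, ?_⟩
  rintro _ ⟨ξ, rfl⟩
  exact M.norm_toEuclideanLin_le (mem_closedBall_zero_iff.1 ξ.2)

lemma Matrix.iSup_norm_toEuclideanLin_le (M : Matrix ι ι ℝ) :
    ⨆ ξ : Metric.closedBall (0 : EuclideanSpace ℝ ι) 1, ‖Matrix.toEuclideanLin M ξ‖
      ≤ Fintype.card ι * ‖M.toComplex‖ := by
  have : Nonempty (Metric.closedBall (0 : EuclideanSpace ℝ ι) 1) := ⟨⟨0, by simp⟩⟩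
  exact ciSup_le fun ξ => M.norm_toEuclideanLin_le (mem_closedBall_zero_iff.1 ξ.2)

lemma Matrix.norm_toEuclideanLin_le_iSup (M : Matrix ι ι ℝ) (ξ : EuclideanSpace ℝ ι) :
    ‖Matrix.toEuclideanLin M ξ‖ ≤
      (⨆ ξ : Metric.closedBall (0 : EuclideanSpace ℝ ι) 1, ‖Matrix.toEuclideanLin M ξ‖) * ‖ξ‖ := by
  by_cases h0 : ξ = 0
  · simp [h0]
  have hpos : 0 < ‖ξ‖ := norm_pos_iff.2 h0
  have := le_ciSup M.bddAbove_norm_toEuclideanLin ⟨(‖ξ‖⁻¹ : ℝ) • ξ, by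
    simp [norm_smul, hpos.ne']⟩
  simp only [map_smul, norm_smul, norm_inv, norm_norm] at this
  rwa [inv_mul_eq_div, div_le_iff₀ hpos] at this

lemma Matrix.toEuclideanLin_single_apply (M : Matrix ι ι ℝ) (i j : ι) :
    Matrix.toEuclideanLin M (EuclideanSpace.single j 1) i = M i j := by
  simp [Matrix.toLpLin_apply]

lemma Matrix.norm_toComplex_le_iSup (M : Matrix ι ι ℝ) :
    ‖M.toComplex‖ ≤ Fintype.card ι *
      ⨆ ξ : Metric.closedBall (0 : EuclideanSpace ℝ ι) 1, ‖Matrix.toEuclideanLin M ξ‖ := by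
  refine M.norm_toComplex_le (Real.iSup_nonneg fun _ => norm_nonneg _) fun i j => ?_
  have h1 := M.norm_toEuclideanLin_le_iSup (EuclideanSpace.single j 1)
  rw [PiLp.norm_single, norm_one, mul_one] at h1
  refine le_trans ?_ h1
  have h2 := PiLp.norm_apply_le (Matrix.toEuclideanLin M (EuclideanSpace.single j 1)) i
  rwa [Matrix.toEuclideanLin_single_apply, Real.norm_eq_abs] at h2

/-- Dimension factors disappear after taking `t`-th roots. -/
lemma tendsto_const_rpow_inv_nat {c : ℝ} (hc : 0 < c) :
    Tendsto (fun t : ℕ => c ^ (1 / (t : ℝ))) atTop (𝓝 1) := by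
  have h := (Real.continuousAt_const_rpow (b := 0) hc.ne').tendsto.comp
    (tendsto_one_div_atTop_nhds_zero_nat (𝕜 := ℝ))
  simpa [Function.comp_def] using h

/-- Every eigenvalue of `T` other than `1` is bounded by the convergence rate. -/
lemma IsConvergenceRate.norm_le {T : Matrix ι ι ℝ} {r : ℝ} (h : IsConvergenceRate T r) {μ : ℂ}
    (hμ : T.toComplex.IsEigval μ) (hμ1 : μ ≠ 1) : ‖μ‖ ≤ r := by
  obtain ⟨limit, hlim, hrate⟩ := h
  obtain ⟨x, hx, hT⟩ := hμ
  -- A pointwise limit of linear maps is linear, so the limit is given by a matrix `P`.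
  let Λ : EuclideanSpace ℝ ι →ₗ[ℝ] EuclideanSpace ℝ ι :=
    linearMapOfTendsto limit (fun t : ℕ => Matrix.toEuclideanLin (T ^ t)) (tendsto_pi_nhds.2 hlim)
  obtain ⟨P, hP⟩ : ∃ P : Matrix ι ι ℝ, ∀ ξ, limit ξ = Matrix.toEuclideanLin P ξ :=
    ⟨Matrix.toEuclideanLin.symm Λ, fun ξ => by rw [LinearEquiv.apply_symm_apply]; rfl⟩
  simp only [hP] at hlim hrate
  have hpow : ∀ t : ℕ, (T ^ t).toComplex *ᵥ x = μ ^ t • x := by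
    intro t
    induction t with
    | zero => simp [Matrix.toComplex, Matrix.map_one]
    | succ t ih =>
      rw [pow_succ, Matrix.toComplex, Matrix.map_mul, ← Matrix.mulVec_mulVec, hT,
        Matrix.mulVec_smul, ih, smul_smul, pow_succ']
  have hent : ∀ i j, Tendsto (fun t : ℕ => (T ^ t) i j) atTop (𝓝 (P i j)) := by
    intro i j
    have h1 := hlim (EuclideanSpace.single j 1)
    have h2 := ((PiLp.continuous_apply 2 (fun _ : ι => ℝ) i).tendsto _).comp h1
    simpa only [Function.comp_def, Matrix.toEuclideanLin_single_apply] using h2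
  have hentC : ∀ i, Tendsto (fun t : ℕ => ((T ^ t).toComplex *ᵥ x) i) atTop
      (𝓝 ((P.toComplex *ᵥ x) i)) := by
    intro i
    refine tendsto_finsetSum _ fun j _ => ?_
    exact ((Complex.continuous_ofReal.tendsto _).comp (hent i j)).mul_const _
  simp only [hpow] at hentC
  obtain ⟨i₀, hi₀⟩ := Function.ne_iff.1 hx
  have hi₀ : x i₀ ≠ 0 := hi₀
  have hconv : Tendsto (fun t : ℕ => μ ^ t) atTop (𝓝 ((P.toComplex *ᵥ x) i₀ / x i₀)) := by
    have := (hentC i₀).div_const (x i₀)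
    simpa [hi₀] using this
  -- The limit of `μ ^ t` is unchanged by multiplication by `μ ≠ 1`, hence it is zero. So `P` kills
  -- `x`, and the error on `x` is exactly `μ ^ t • x`.
  have hzero : (P.toComplex *ᵥ x) i₀ / x i₀ = 0 := by
    have h1 := hconv.comp (tendsto_add_atTop_nat 1)
    have h2 := hconv.const_mul μ
    have h3 : (fun t : ℕ => μ * μ ^ t) = (fun t : ℕ => μ ^ t) ∘ fun t => t + 1 := by
      ext t; simp [pow_succ']
    rw [h3] at h2
    have h4 := tendsto_nhds_unique h1 h2
    have h5 : (μ - 1) * ((P.toComplex *ᵥ x) i₀ / x i₀) = 0 := by linear_combination -h4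
    exact (mul_eq_zero.1 h5).resolve_left (sub_ne_zero.2 hμ1)
  rw [hzero] at hconv
  have hPx : P.toComplex *ᵥ x = 0 := by
    ext i
    refine tendsto_nhds_unique (hentC i) ?_
    simpa using hconv.mul_const (x i)
  set E : ℕ → ℝ := fun t => ⨆ ξ : Metric.closedBall (0 : EuclideanSpace ℝ ι) 1,
    ‖Matrix.toEuclideanLin (T ^ t - P) ξ‖ with hE
  have hrate' : Tendsto (fun t : ℕ => E t ^ (1 / (t : ℝ))) atTop (𝓝 r) := by
    simpa only [hE, map_sub, LinearMap.sub_apply] using hrate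
  have hE0 : ∀ t, 0 ≤ E t := fun t => Real.iSup_nonneg fun _ => norm_nonneg _
  have hxpos : 0 < ‖x‖ := norm_pos_iff.2 hx
  have hn : (0 : ℝ) < Fintype.card ι := by
    have : Nonempty ι := ⟨i₀⟩
    exact_mod_cast Fintype.card_pos
  have hbound : ∀ t, ‖μ‖ ^ t ≤ Fintype.card ι * E t := by
    intro t
    refine le_trans ?_ (T ^ t - P).norm_toComplex_le_iSup
    have h1 : (T ^ t - P).toComplex *ᵥ x = μ ^ t • x := by
      rw [Matrix.toComplex, Matrix.map_sub _ (map_sub _), Matrix.sub_mulVec]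
      rw [hpow t, hPx, sub_zero]
    have h2 := Matrix.linfty_opNorm_mulVec (T ^ t - P).toComplex x
    rw [h1, norm_smul, norm_pow] at h2
    exact le_of_mul_le_mul_right h2 hxpos
  have hlim1 : Tendsto (fun t : ℕ => (Fintype.card ι : ℝ) ^ (1 / (t : ℝ)) * E t ^ (1 / (t : ℝ)))
      atTop (𝓝 r) := by
    simpa using (tendsto_const_rpow_inv_nat hn).mul hrate'
  refine ge_of_tendsto hlim1 ?_
  filter_upwards [eventually_ge_atTop 1] with t ht
  rw [← Real.mul_rpow hn.le (hE0 t)]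
  calc ‖μ‖ = (‖μ‖ ^ t) ^ (1 / (t : ℝ)) := by
        rw [one_div, Real.pow_rpow_inv_natCast (norm_nonneg _) (by omega)]
    _ ≤ _ := Real.rpow_le_rpow (by positivity) (hbound t) (by positivity)

namespace Matrix.FixesConst

variable {T : Matrix ι ι ℝ} {φ : ι → ℝ} (h : T.FixesConst φ)
include h

/-- If the spectral radius of `T` away from `1` is `τ < 1`, then `τ` is the convergence rate. -/
lemma isConvergenceRate {τ : ℝ} (hle : ∀ μ : ℂ, T.toComplex.IsEigval μ → μ ≠ 1 → ‖μ‖ ≤ τ)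
    (hex : ∃ μ : ℂ, T.toComplex.IsEigval μ ∧ μ ≠ 1 ∧ ‖μ‖ = τ) (hτ : τ < 1) :
    IsConvergenceRate T τ := by
  -- `P` is the projection onto the constants along the kernel of `φ`; subtracting it from `T`
  -- removes the eigenvalue 1.
  set P : Matrix ι ι ℝ := (φ ⬝ᵥ 1)⁻¹ • Matrix.vecMulVec 1 φ with hPdef
  have hTP : T * P = P := by rw [hPdef, Matrix.mul_smul, Matrix.mul_vecMulVec, h.right]
  have hPT : P * T = P := by rw [hPdef, Matrix.smul_mul, Matrix.vecMulVec_mul, h.left]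
  have hP1 : P *ᵥ 1 = 1 := by
    rw [hPdef, Matrix.smul_mulVec, Matrix.vecMulVec_mulVec]
    ext i
    simp [h.ne]
  have hPP : P * P = P := by
    conv_lhs => rw [hPdef]
    rw [Matrix.mul_smul, Matrix.mul_vecMulVec, hP1]
  set S := T - P with hS
  -- False for exponent zero, where `S ^ 0 = 1`; hence the restriction to `t ≥ 1` below.
  have hpow : ∀ t : ℕ, S ^ (t + 1) = T ^ (t + 1) - P := by
    have hPt : ∀ t : ℕ, P * T ^ t = P := by
      intro t
      induction t with
      | zero => simp
      | succ t ih => rw [pow_succ, ← mul_assoc, ih, hPT]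
    intro t
    induction t with
    | zero => simp [hS]
    | succ t ih =>
      rw [pow_succ', ih, hS, sub_mul, mul_sub, mul_sub, hTP, hPP, hPt, ← pow_succ']
      simp
  set PC := P.toComplex with hPC
  have hSC : S.toComplex = T.toComplex - PC := by
    rw [hS, Matrix.toComplex, Matrix.map_sub _ (map_sub _)]
  have hPTC : PC * T.toComplex = PC := by rw [hPC, Matrix.toComplex, ← Matrix.map_mul, hPT]
  have hPPC : PC * PC = PC := by rw [hPC, Matrix.toComplex, ← Matrix.map_mul, hPP]
  have hPC1 : ∀ c : ℂ, PC *ᵥ (fun _ => c) = fun _ => c := by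
    intro c
    have h1 : PC *ᵥ (fun _ => (1 : ℂ)) = fun _ => 1 := by
      have := P.toComplex_mulVec_ofReal 1
      rw [hP1] at this
      simpa using this
    have h2 : (fun _ : ι => c) = c • fun _ : ι => (1 : ℂ) := by ext; simp
    rw [h2, Matrix.mulVec_smul, h1]
  -- As `P * S = 0`, an eigenvector of `S` with nonzero eigenvalue is killed by `P`, so it is an
  -- eigenvector of `T`. It is not constant, which excludes the eigenvalue 1.
  have hle' : ∀ μ ∈ spectrum ℂ S.toComplex, ‖μ‖ ≤ τ := by
    intro μ hμ
    have hτ0 : 0 ≤ τ := by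
      obtain ⟨ν, -, -, rfl⟩ := hex
      exact norm_nonneg _
    by_cases hμ0 : μ = 0
    · simpa [hμ0] using hτ0
    obtain ⟨x, hx, hxS⟩ : S.toComplex.IsEigval μ := by
      rw [Matrix.isEigval_iff_mem_roots, Polynomial.mem_roots (Matrix.charpoly_monic _).ne_zero]
      exact Matrix.mem_spectrum_iff_isRoot_charpoly.1 hμ
    have h1 : PC *ᵥ x = 0 := by
      have h2 : PC *ᵥ (S.toComplex *ᵥ x) = 0 := by
        rw [Matrix.mulVec_mulVec, hSC, mul_sub, hPTC, hPPC, sub_self, Matrix.zero_mulVec]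
      rw [hxS, Matrix.mulVec_smul] at h2
      exact (smul_eq_zero.1 h2).resolve_left hμ0
    have h2 : T.toComplex *ᵥ x = μ • x := by
      rw [← hxS, hSC, Matrix.sub_mulVec, h1, sub_zero]
    refine hle μ ⟨x, hx, h2⟩ ?_
    rintro rfl
    obtain ⟨c, rfl⟩ := h.const_complex (by rw [h2, one_smul])
    exact hx (by rw [← hPC1 c, h1])
  have hex' : ∃ μ ∈ spectrum ℂ S.toComplex, ‖μ‖ = τ := by
    obtain ⟨μ, ⟨x, hx, hxT⟩, hμ1, hμτ⟩ := hex
    refine ⟨μ, ?_, hμτ⟩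
    rw [Matrix.mem_spectrum_iff_isRoot_charpoly,
      ← Polynomial.mem_roots (Matrix.charpoly_monic _).ne_zero, ← Matrix.isEigval_iff_mem_roots]
    refine ⟨x, hx, ?_⟩
    have h2 : PC *ᵥ (T.toComplex *ᵥ x) = PC *ᵥ x := by rw [Matrix.mulVec_mulVec, hPTC]
    rw [hxT, Matrix.mulVec_smul, ← sub_eq_zero] at h2
    have h3 : (μ - 1) • (PC *ᵥ x) = 0 := by rw [sub_smul, one_smul, h2]
    have h4 := (smul_eq_zero.1 h3).resolve_left (sub_ne_zero.2 hμ1)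
    rw [hSC, Matrix.sub_mulVec, h4, sub_zero, hxT]
  have hrad : spectralRadius ℂ S.toComplex = ENNReal.ofReal τ := by
    refine le_antisymm (iSup₂_le fun μ hμ => ?_) ?_
    · rw [← enorm_eq_nnnorm, ← ofReal_norm μ]
      exact ENNReal.ofReal_le_ofReal (hle' μ hμ)
    · obtain ⟨μ, hμ, rfl⟩ := hex'
      rw [ofReal_norm μ]
      exact le_iSup₂ (f := fun k (_ : k ∈ spectrum ℂ S.toComplex) => (‖k‖₊ : ENNReal)) μ hμ
  have hτ0 : 0 ≤ τ := by
    obtain ⟨ν, -, -, rfl⟩ := hex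
    exact norm_nonneg _
  set N : ℕ → ℝ := fun t => ‖(S ^ t).toComplex‖ with hN
  have hgel : Tendsto (fun t : ℕ => N t ^ (1 / (t : ℝ))) atTop (𝓝 τ) := by
    have h1 := spectrum.pow_norm_pow_one_div_tendsto_nhds_spectralRadius S.toComplex
    rw [hrad] at h1
    have h2 := (ENNReal.tendsto_toReal ENNReal.ofReal_ne_top).comp h1
    rw [ENNReal.toReal_ofReal hτ0] at h2
    refine h2.congr fun t => ?_
    have h3 : (S ^ t).toComplex = S.toComplex ^ t := Matrix.map_pow S (algebraMap ℝ ℂ) t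
    simp only [Function.comp, hN]
    rw [ENNReal.toReal_ofReal (by positivity), h3]
  have hNz : Tendsto N atTop (𝓝 0) := by
    obtain ⟨r, hr1, hr2⟩ := exists_between hτ
    refine squeeze_zero' (Eventually.of_forall fun t => norm_nonneg _) ?_
      (tendsto_pow_atTop_nhds_zero_of_lt_one (hτ0.trans hr1.le) hr2)
    filter_upwards [hgel.eventually_lt_const hr1, eventually_ge_atTop 1] with t ht ht1
    have h1 : (N t ^ (1 / (t : ℝ))) ^ t = N t := by
      rw [one_div, Real.rpow_inv_natCast_pow (norm_nonneg _) (by omega)]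
    rw [← h1]
    exact pow_le_pow_left₀ (Real.rpow_nonneg (norm_nonneg _) _) ht.le t
  have hn : (0 : ℝ) < Fintype.card ι := by
    obtain ⟨i, -⟩ := Function.ne_iff.1 h.one_ne_zero
    have : Nonempty ι := ⟨i⟩
    exact_mod_cast Fintype.card_pos
  refine ⟨fun ξ => Matrix.toEuclideanLin P ξ, fun ξ => ?_, ?_⟩
  · rw [tendsto_iff_norm_sub_tendsto_zero]
    refine squeeze_zero' (Eventually.of_forall fun t => norm_nonneg _) ?_
      (g := fun t => Fintype.card ι * N t * ‖ξ‖) (by simpa using (hNz.const_mul _).mul_const _)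
    filter_upwards [eventually_ge_atTop 1] with t ht
    obtain ⟨t, rfl⟩ := Nat.exists_eq_add_of_le' ht
    rw [← LinearMap.sub_apply, ← map_sub, ← hpow]
    exact ((S ^ (t + 1)).norm_toEuclideanLin_le_iSup ξ).trans
      (mul_le_mul_of_nonneg_right (S ^ (t + 1)).iSup_norm_toEuclideanLin_le (norm_nonneg _))
  · have hup : Tendsto (fun t : ℕ => (Fintype.card ι : ℝ) ^ (1 / (t : ℝ)) * N t ^ (1 / (t : ℝ)))
        atTop (𝓝 τ) := by
      simpa using (tendsto_const_rpow_inv_nat hn).mul hgel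
    have hlow : Tendsto (fun t : ℕ => ((Fintype.card ι : ℝ)⁻¹) ^ (1 / (t : ℝ)) *
        N t ^ (1 / (t : ℝ))) atTop (𝓝 τ) := by
      simpa using (tendsto_const_rpow_inv_nat (inv_pos.2 hn)).mul hgel
    refine tendsto_of_tendsto_of_tendsto_of_le_of_le' hlow hup ?_ ?_
    · filter_upwards [eventually_ge_atTop 1] with t ht
      obtain ⟨t, rfl⟩ := Nat.exists_eq_add_of_le' ht
      simp only [← LinearMap.sub_apply, ← map_sub, ← hpow]
      rw [← Real.mul_rpow (by positivity) (norm_nonneg _)]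
      refine Real.rpow_le_rpow (by positivity) ?_ (by positivity)
      rw [inv_mul_le_iff₀ hn]
      exact (S ^ (t + 1)).norm_toComplex_le_iSup
    · filter_upwards [eventually_ge_atTop 1] with t ht
      obtain ⟨t, rfl⟩ := Nat.exists_eq_add_of_le' ht
      simp only [← LinearMap.sub_apply, ← map_sub, ← hpow]
      rw [← Real.mul_rpow (by positivity) (norm_nonneg _)]
      refine Real.rpow_le_rpow (Real.iSup_nonneg fun _ => norm_nonneg _) ?_ (by positivity)
      exact (S ^ (t + 1)).iSup_norm_toEuclideanLin_le

end Matrix.FixesConst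

end ConvergenceRate

/-! ### Rayleigh quotients of symmetric matrices. -/

section Rayleigh

open Matrix

variable {ι : Type*} [Fintype ι] [DecidableEq ι]

/-- A quadratic form is bounded, on the orthogonal complement of an eigenvector, by the eigenvalues
whose eigenvectors lie there. -/
lemma Matrix.IsSymm.dotProduct_mulVec_le {M : Matrix ι ι ℝ} (hM : M.IsSymm) {φ : ι → ℝ} {c b : ℝ}
    (hφ : M *ᵥ φ = c • φ)
    (hb : ∀ (μ : ℝ) (x : ι → ℝ), x ≠ 0 → x ⬝ᵥ φ = 0 → M *ᵥ x = μ • x → μ ≤ b)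
    {z : ι → ℝ} (hz : z ⬝ᵥ φ = 0) : z ⬝ᵥ M *ᵥ z ≤ b * (z ⬝ᵥ z) := by
  -- The rank-one term leaves the complement of `φ` alone and moves the eigenvalue at `φ` to `b - c
  -- + |c - b| ≥ 0`, so that `N` is positive semidefinite. For `φ = 0` the quotient defaults to 0,
  -- and the bound holds on the whole space.
  set t : ℝ := |c - b| / (φ ⬝ᵥ φ) with ht
  set N : Matrix ι ι ℝ := b • 1 - M + t • Matrix.vecMulVec φ φ with hN
  have hNv : ∀ x, N *ᵥ x = b • x - M *ᵥ x + (t * (x ⬝ᵥ φ)) • φ := by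
    intro x
    rw [hN, Matrix.add_mulVec, Matrix.sub_mulVec, Matrix.smul_mulVec, Matrix.one_mulVec,
      Matrix.smul_mulVec, Matrix.vecMulVec_mulVec, dotProduct_comm φ x]
    ext i
    simp [mul_assoc, mul_comm]
  have hNH : N.IsHermitian := by
    rw [Matrix.IsHermitian, Matrix.conjTranspose_eq_transpose_of_trivial, hN,
      Matrix.transpose_add, Matrix.transpose_sub, hM.eq, Matrix.transpose_smul,
      Matrix.transpose_smul, Matrix.transpose_one, Matrix.transpose_vecMulVec]
  have hpos : N.PosSemidef := by
    rw [hNH.posSemidef_iff_eigenvalues_nonneg]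
    intro j
    set ν := hNH.eigenvalues j
    obtain ⟨x, hx, hNx⟩ : N.IsEigval ν := by
      refine ⟨(hNH.eigenvectorBasis j).ofLp, fun h0 => ?_, hNH.mulVec_eigenvectorBasis j⟩
      have := hNH.eigenvectorBasis.orthonormal.ne_zero j
      exact this (by ext i; exact congrFun h0 i)
    show 0 ≤ ν
    have hMφ : ∀ y, y ⬝ᵥ φ = 0 → (M *ᵥ y) ⬝ᵥ φ = 0 := by
      intro y hy
      rw [dotProduct_comm, Matrix.dotProduct_mulVec, ← Matrix.mulVec_transpose, hM.eq, hφ,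
        smul_dotProduct, dotProduct_comm, hy, smul_zero]
    by_cases hφ0 : φ = 0
    · have h1 : M *ᵥ x = (b - ν) • x := by
        have := hNv x
        rw [hNx, hφ0, smul_zero, add_zero] at this
        rw [sub_smul, this, sub_sub_cancel]
      linarith [hb _ x hx (by simp [hφ0]) h1]
    have hφφ : φ ⬝ᵥ φ ≠ 0 := fun h => hφ0 (dotProduct_self_eq_zero.1 h)
    have hκ : N *ᵥ φ = (b - c + |c - b|) • φ := by
      rw [hNv, hφ, ht, div_mul_cancel₀ _ hφφ, ← sub_smul, ← add_smul]
    -- Split the eigenvector along `φ`. Since `N` preserves the complement, either the component `y`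
    -- in it is an eigenvector or `x` is a multiple of `φ`.
    set a : ℝ := (x ⬝ᵥ φ) / (φ ⬝ᵥ φ) with ha
    set y := x - a • φ with hy
    have hyφ : y ⬝ᵥ φ = 0 := by
      rw [hy, sub_dotProduct, smul_dotProduct, smul_eq_mul, ha, div_mul_cancel₀ _ hφφ, sub_self]
    have hNy : N *ᵥ y = ν • y + (a * (ν - (b - c + |c - b|))) • φ := by
      rw [hy, Matrix.mulVec_sub, Matrix.mulVec_smul, hNx, hκ]
      ext i
      simp
      ring
    have h0 : a * (ν - (b - c + |c - b|)) = 0 := by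
      have h1 : (N *ᵥ y) ⬝ᵥ φ = 0 := by
        rw [hNv, hyφ, mul_zero, zero_smul, add_zero, sub_dotProduct, smul_dotProduct, hyφ,
          hMφ y hyφ, smul_zero, sub_zero]
      rw [hNy, add_dotProduct, smul_dotProduct, hyφ, smul_zero, zero_add, smul_dotProduct,
        smul_eq_mul] at h1
      exact (mul_eq_zero.1 h1).resolve_right hφφ
    by_cases hy0 : y = 0
    · have ha0 : a ≠ 0 := by
        intro ha0
        rw [hy0, ha0, zero_smul, sub_zero] at hy
        exact hx hy.symm
      have h1 := (mul_eq_zero.1 h0).resolve_left ha0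
      have := le_abs_self (c - b)
      linarith
    · have h1 : M *ᵥ y = (b - ν) • y := by
        have := hNv y
        rw [hNy, h0, hyφ, mul_zero, zero_smul, add_zero, add_zero] at this
        rw [sub_smul, this, sub_sub_cancel]
      linarith [hb _ y hy0 hyφ h1]
  have h1 := hpos.dotProduct_mulVec_nonneg z
  rw [star_trivial, hNv, hz, mul_zero, zero_smul, add_zero, dotProduct_sub, dotProduct_smul,
    smul_eq_mul] at h1
  linarith

lemma Matrix.IsEigval.exists_real {M : Matrix ι ι ℝ} (hM : M.charpoly.Splits) {μ : ℂ}
    (hμ : M.toComplex.IsEigval μ) : ∃ ω : ℝ, μ = ω ∧ M.IsEigval ω := by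
  rw [Matrix.isEigval_iff_mem_roots, Matrix.toComplex, Matrix.charpoly_map, hM.roots_map] at hμ
  obtain ⟨ω, hω, rfl⟩ := Multiset.mem_map.1 hμ
  exact ⟨ω, rfl, (Matrix.isEigval_iff_mem_roots _ _).2 hω⟩

end Rayleigh

/-! ### The spectrum of the random walk and its gap. -/

namespace SimpleGraph

open Matrix

variable {V : Type*} [Fintype V] {G : SimpleGraph V} [DecidableRel G.Adj]

lemma Connected.degree_real_pos [Nontrivial V] (hG : G.Connected) (i : V) :
    (0 : ℝ) < G.degree i := by
  exact_mod_cast hG.preconnected.degree_pos_of_nontrivial i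

variable [DecidableEq V]

lemma dotProduct_lapMatrix_mulVec (G : SimpleGraph V) [DecidableRel G.Adj] (x : V → ℝ) :
    x ⬝ᵥ G.lapMatrix ℝ *ᵥ x = (∑ i, ∑ j, if G.Adj i j then (x i - x j) ^ 2 else 0) / 2 := by
  rw [← lapMatrix_toLinearMap₂', Matrix.toLinearMap₂'_apply']

lemma Connected.exists_eq_const (hG : G.Connected) {x : V → ℝ} (hx : G.lapMatrix ℝ *ᵥ x = 0) :
    ∃ c : ℝ, x = c • (1 : V → ℝ) := by
  rw [lapMatrix_mulVec_eq_zero_iff_forall_reachable] at hx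
  obtain ⟨i⟩ := hG.nonempty
  exact ⟨x i, by ext j; simpa using hx j i (hG.preconnected j i)⟩

lemma Connected.walkMatrix_eq [Nontrivial V] (hG : G.Connected) :
    G.walkMatrix = Matrix.diagonal (fun i => (G.degree i : ℝ)⁻¹) * G.adjMatrix ℝ := by
  rw [walkMatrix, degMatrix]
  congr 1
  refine Matrix.inv_eq_right_inv ?_
  rw [Matrix.diagonal_mul_diagonal, ← Matrix.diagonal_one]
  congr 1
  ext i
  exact mul_inv_cancel₀ (hG.degree_real_pos i).ne'

lemma Connected.walkMatrix_mulVec_eq_iff [Nontrivial V] (hG : G.Connected) {x : V → ℝ} {μ : ℝ} :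
    G.walkMatrix *ᵥ x = μ • x ↔ ∀ i, (G.adjMatrix ℝ *ᵥ x) i = μ * (G.degree i * x i) := by
  rw [hG.walkMatrix_eq, ← Matrix.mulVec_mulVec, funext_iff]
  refine forall_congr' fun i => ?_
  rw [Matrix.mulVec_diagonal, Pi.smul_apply, smul_eq_mul, inv_mul_eq_iff_eq_mul₀
    (hG.degree_real_pos i).ne', mul_left_comm]

lemma Connected.fixesConst_walkMatrix [Nontrivial V] (hG : G.Connected) :
    G.walkMatrix.FixesConst (fun i => (G.degree i : ℝ)) where
  right := by
    have := (hG.walkMatrix_mulVec_eq_iff (x := 1) (μ := 1)).2 fun i => by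
      rw [adjMatrix_mulVec_apply]; simp
    rwa [one_smul] at this
  left := by
    rw [hG.walkMatrix_eq, ← Matrix.vecMul_vecMul]
    have h1 : (fun i => (G.degree i : ℝ)) ᵥ* Matrix.diagonal (fun i => (G.degree i : ℝ)⁻¹) = 1 := by
      ext i
      rw [Matrix.vecMul_diagonal, mul_inv_cancel₀ (hG.degree_real_pos i).ne', Pi.one_apply]
    rw [h1, ← Matrix.mulVec_transpose, transpose_adjMatrix]
    ext i
    rw [adjMatrix_mulVec_apply]
    simp
  ne := by
    obtain ⟨i⟩ := hG.nonempty
    rw [dotProduct_one]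
    exact (Finset.sum_pos (fun i _ => hG.degree_real_pos i) ⟨i, Finset.mem_univ i⟩).ne'
  const x hx := by
    refine hG.exists_eq_const ?_
    have h1 := (hG.walkMatrix_mulVec_eq_iff (x := x) (μ := 1)).1 (by rw [hx, one_smul])
    ext i
    rw [lapMatrix, Matrix.sub_mulVec, Pi.sub_apply, degMatrix_mulVec_apply, h1]
    simp

/-- The symmetric normalization `𝒟^{-1/2} 𝒜 𝒟^{-1/2}` of the adjacency matrix. -/
noncomputable def normalizedAdjMatrix {V : Type*} [Fintype V] [DecidableEq V] (G : SimpleGraph V)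
    [DecidableRel G.Adj] : Matrix V V ℝ :=
  Matrix.diagonal (fun i => (√(G.degree i))⁻¹) * G.adjMatrix ℝ *
    Matrix.diagonal (fun i => (√(G.degree i))⁻¹)

lemma isSymm_normalizedAdjMatrix : G.normalizedAdjMatrix.IsSymm := by
  rw [Matrix.IsSymm, normalizedAdjMatrix, Matrix.transpose_mul, Matrix.transpose_mul,
    Matrix.diagonal_transpose, transpose_adjMatrix, mul_assoc]

lemma normalizedAdjMatrix_mulVec (x : V → ℝ) (i : V) :
    (G.normalizedAdjMatrix *ᵥ x) i =
      (√(G.degree i))⁻¹ * (G.adjMatrix ℝ *ᵥ fun j => (√(G.degree j))⁻¹ * x j) i := by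
  rw [normalizedAdjMatrix, ← Matrix.mulVec_mulVec, ← Matrix.mulVec_mulVec, Matrix.mulVec_diagonal]
  congr 3
  ext j
  rw [Matrix.mulVec_diagonal]

/-- The characteristic polynomial of a product does not depend on the order of the factors, so one
factor `𝒟^{-1/2}` can be moved to the other side. This is what makes the spectrum of the walk real.
-/
lemma Connected.charpoly_walkMatrix [Nontrivial V] (hG : G.Connected) :
    G.walkMatrix.charpoly = G.normalizedAdjMatrix.charpoly := by
  rw [normalizedAdjMatrix, Matrix.charpoly_mul_comm, ← mul_assoc, Matrix.diagonal_mul_diagonal,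
    hG.walkMatrix_eq]
  congr 3
  ext i
  rw [← mul_inv, Real.mul_self_sqrt (Nat.cast_nonneg _)]

lemma Connected.splits_charpoly_walkMatrix [Nontrivial V] (hG : G.Connected) :
    G.walkMatrix.charpoly.Splits := by
  rw [hG.charpoly_walkMatrix]
  refine Matrix.IsHermitian.splits_charpoly ?_
  rw [Matrix.IsHermitian, Matrix.conjTranspose_eq_transpose_of_trivial, isSymm_normalizedAdjMatrix]

/-- Maximum principle: compare at a vertex where `|x|` is largest. -/
lemma Connected.abs_le_one_of_isEigval [Nontrivial V] (hG : G.Connected) {μ : ℝ}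
    (hμ : G.walkMatrix.IsEigval μ) : |μ| ≤ 1 := by
  obtain ⟨x, hx, hW⟩ := hμ
  rw [hG.walkMatrix_mulVec_eq_iff] at hW
  obtain ⟨i, -, hi⟩ := Finset.exists_max_image Finset.univ (fun i => |x i|)
    ⟨_, Finset.mem_univ hG.nonempty.some⟩
  have hxi : 0 < |x i| := by
    obtain ⟨j, hj⟩ := Function.ne_iff.1 hx
    exact (abs_pos.2 hj).trans_le (hi j (Finset.mem_univ j))
  have h1 : |(G.adjMatrix ℝ *ᵥ x) i| ≤ G.degree i * |x i| := by
    rw [adjMatrix_mulVec_apply]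
    refine (Finset.abs_sum_le_sum_abs _ _).trans ?_
    refine (Finset.sum_le_card_nsmul _ _ _ fun j _ => hi j (Finset.mem_univ j)).trans ?_
    rw [card_neighborFinset_eq_degree, nsmul_eq_mul]
  have hpos := mul_pos (hG.degree_real_pos i) hxi
  rw [hW, abs_mul, abs_mul, Nat.abs_cast] at h1
  exact le_of_mul_le_mul_right (by linarith) hpos

/-- As 1 is a simple root, the second entry of the sorted list is the largest remaining root. One
remains because the polynomial splits and there are at least two vertices. -/
lemma Connected.omegaStar_spec [Nontrivial V] (hG : G.Connected) :
    G.walkMatrix.IsEigval G.omegaStar ∧ G.omegaStar < 1 ∧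
      ∀ μ : ℝ, G.walkMatrix.IsEigval μ → μ ≠ 1 → μ ≤ G.omegaStar := by
  classical
  have hF := hG.fixesConst_walkMatrix
  set R := G.walkMatrix.charpoly.roots with hR
  have h1 : (1 : ℝ) ∈ R := (Matrix.isEigval_iff_mem_roots _ _).1 hF.isEigval_one
  have hn : (1 : ℝ) ∉ R.erase 1 := by
    rw [← Multiset.count_eq_zero, Multiset.count_erase_self, hF.count_roots]
  have hcard : R.card = Fintype.card V := by
    rw [hR, ← hG.splits_charpoly_walkMatrix.natDegree_eq_card_roots,
      Matrix.charpoly_natDegree_eq_dim]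
  have hne : (R.erase 1).toFinset.Nonempty := by
    rw [Multiset.toFinset_nonempty, ne_eq, ← Multiset.card_eq_zero, Multiset.card_erase_of_mem h1,
      hcard]
    have := Fintype.one_lt_card (α := V)
    simp only [Nat.pred_eq_sub_one]
    omega
  obtain ⟨b, hb, hmax⟩ := Finset.exists_max_image _ id hne
  simp only [Multiset.mem_toFinset, id] at hb hmax
  have hbE : G.walkMatrix.IsEigval b :=
    (Matrix.isEigval_iff_mem_roots _ _).2 (Multiset.mem_of_mem_erase hb)
  have hb1 : b ≤ 1 := (abs_le.1 (hG.abs_le_one_of_isEigval hbE)).2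
  have hω : G.omegaStar = b := by
    rw [omegaStar, eigenvaluesDesc, ← hR, ← Multiset.cons_erase h1]
    exact Multiset.sort_getD_one hb hmax hb1
  rw [hω]
  refine ⟨hbE, lt_of_le_of_ne hb1 fun h => hn (h ▸ hb), fun μ hμ hμ1 => hmax μ ?_⟩
  rw [Multiset.mem_erase_of_ne hμ1]
  exact (Matrix.isEigval_iff_mem_roots _ _).1 hμ

/-- The variational characterization of the spectral gap of the random walk. -/
lemma Connected.gap_mul_sum_le [Nontrivial V] (hG : G.Connected) {y : V → ℝ}
    (hy : ∑ i, (G.degree i : ℝ) * y i = 0) :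
    (1 - G.omegaStar) * ∑ i, (G.degree i : ℝ) * y i ^ 2 ≤ y ⬝ᵥ G.lapMatrix ℝ *ᵥ y := by
  have hs : ∀ i, 0 < √(G.degree i : ℝ) := fun i => Real.sqrt_pos.2 (hG.degree_real_pos i)
  have hss : ∀ i, √(G.degree i : ℝ) * √(G.degree i : ℝ) = G.degree i := fun i =>
    Real.mul_self_sqrt (Nat.cast_nonneg _)
  have hred : ∀ v : V → ℝ, (fun j => (√(G.degree j : ℝ))⁻¹ * (√(G.degree j : ℝ) * v j)) = v := by
    intro v
    ext j
    rw [inv_mul_cancel_left₀ (hs j).ne']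
  -- Substitute `𝒟^{1/2} y`; the condition on `y` becomes orthogonality to the top eigenvector
  -- `𝒟^{1/2} 1`.
  have hN := (isSymm_normalizedAdjMatrix (G := G)).dotProduct_mulVec_le
    (φ := fun i => √(G.degree i : ℝ)) (c := 1) (b := G.omegaStar)
    (z := fun i => √(G.degree i : ℝ) * y i) ?_ ?_ ?_
  · have h1 : (fun i => √(G.degree i : ℝ) * y i) ⬝ᵥ G.normalizedAdjMatrix *ᵥ
        (fun i => √(G.degree i : ℝ) * y i) = y ⬝ᵥ G.adjMatrix ℝ *ᵥ y := by
      refine Finset.sum_congr rfl fun i _ => ?_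
      rw [normalizedAdjMatrix_mulVec, hred]
      field_simp [(hs i).ne']
    have h2 : (fun i => √(G.degree i : ℝ) * y i) ⬝ᵥ (fun i => √(G.degree i : ℝ) * y i) =
        ∑ i, (G.degree i : ℝ) * y i ^ 2 := by
      refine Finset.sum_congr rfl fun i _ => ?_
      rw [← hss i]
      ring
    have h3 : y ⬝ᵥ G.degMatrix ℝ *ᵥ y = ∑ i, (G.degree i : ℝ) * y i ^ 2 := by
      rw [dotProduct_mulVec_degMatrix]
      exact Finset.sum_congr rfl fun i _ => by ring
    rw [h1, h2] at hN
    rw [lapMatrix, Matrix.sub_mulVec, dotProduct_sub, h3]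
    linarith
  · ext i
    rw [normalizedAdjMatrix_mulVec]
    have : (fun j => (√(G.degree j : ℝ))⁻¹ * √(G.degree j : ℝ)) = fun _ => (1 : ℝ) := by
      ext j
      rw [inv_mul_cancel₀ (hs j).ne']
    rw [this, adjMatrix_mulVec_apply]
    simp only [Finset.sum_const, card_neighborFinset_eq_degree, nsmul_eq_mul, mul_one, one_smul]
    rw [inv_mul_eq_iff_eq_mul₀ (hs i).ne', hss]
  · intro μ x hx hxφ hμ
    have hE : G.walkMatrix *ᵥ (fun j => (√(G.degree j : ℝ))⁻¹ * x j) =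
        μ • fun j => (√(G.degree j : ℝ))⁻¹ * x j := by
      rw [hG.walkMatrix_mulVec_eq_iff]
      intro i
      have h1 := congrFun hμ i
      rw [normalizedAdjMatrix_mulVec, inv_mul_eq_iff_eq_mul₀ (hs i).ne'] at h1
      rw [h1, Pi.smul_apply, smul_eq_mul]
      nth_rewrite 2 [← hss i]
      field_simp [(hs i).ne']
    refine hG.omegaStar_spec.2.2 μ ⟨_, fun h0 => hx ?_, hE⟩ ?_
    · ext i
      exact (mul_eq_zero.1 (congrFun h0 i)).resolve_left (inv_pos.2 (hs i)).ne'
    · rintro rfl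
      obtain ⟨c, hc⟩ := hG.fixesConst_walkMatrix.const _ (by rw [hE, one_smul])
      have hxc : ∀ i, x i = c * √(G.degree i : ℝ) := by
        intro i
        have := congrFun hc i
        rw [inv_mul_eq_iff_eq_mul₀ (hs i).ne'] at this
        simpa [mul_comm] using this
      have h2 : c * ∑ i, (G.degree i : ℝ) = 0 := by
        rw [← hxφ, Finset.mul_sum]
        refine Finset.sum_congr rfl fun i _ => ?_
        rw [hxc, mul_assoc, hss]
      have h3 : (0 : ℝ) < ∑ i, (G.degree i : ℝ) :=
        Finset.sum_pos (fun i _ => hG.degree_real_pos i) ⟨_, Finset.mem_univ hG.nonempty.some⟩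
      refine hx ?_
      ext i
      rw [hxc, (mul_eq_zero.1 h2).resolve_right h3.ne', zero_mul, Pi.zero_apply]
  · rw [← hy]
    refine Finset.sum_congr rfl fun i _ => ?_
    rw [← hss i]
    ring

end SimpleGraph

/-! ### Easy Cheeger inequality and bounds for the extreme Laplacian eigenvalues. -/

lemma sum_sq_shift {ι : Type*} [Fintype ι] (w v : ι → ℝ) (c : ℝ) (h : ∑ i, w i * v i = 0) :
    ∑ i, w i * (v i - c) ^ 2 = ∑ i, w i * v i ^ 2 + c ^ 2 * ∑ i, w i := by
  have h1 : ∀ i, w i * (v i - c) ^ 2 = w i * v i ^ 2 - 2 * c * (w i * v i) + c ^ 2 * w i := by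
    intro i; ring
  simp only [h1, Finset.sum_add_distrib, Finset.sum_sub_distrib, ← Finset.mul_sum, h]
  ring

namespace SimpleGraph

open Matrix

variable {V : Type*} [Fintype V] [DecidableEq V] {G : SimpleGraph V} [DecidableRel G.Adj]

lemma card_interedges_eq_sum (s t : Finset V) :
    ((G.interedges s t).card : ℝ) = ∑ i, ∑ j, if i ∈ s ∧ j ∈ t ∧ G.Adj i j then 1 else 0 := by
  have h : G.interedges s t = Finset.univ.filter fun e : V × V =>
      e.1 ∈ s ∧ e.2 ∈ t ∧ G.Adj e.1 e.2 := by
    ext e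
    simp [mem_interedges_iff]
  rw [h, Finset.card_filter, ← Finset.univ_product_univ, Finset.sum_product]
  push_cast
  rfl

/-- The easy half of Cheeger's inequality for a single cut. -/
lemma Connected.gap_mul_min_vol_le [Nontrivial V] (hG : G.Connected) {s : Finset V}
    (hs : s.Nonempty) (hs' : sᶜ.Nonempty) :
    (1 - G.omegaStar) * (min (G.vol s) (G.vol sᶜ) : ℕ) ≤ 2 * (G.interedges s sᶜ).card := by
  set a : ℝ := ((G.vol s : ℕ) : ℝ) with ha
  set b : ℝ := ((G.vol sᶜ : ℕ) : ℝ) with hb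
  set c : ℝ := (((G.interedges s sᶜ).card : ℕ) : ℝ) with hc
  have ha' : a = ∑ i ∈ s, (G.degree i : ℝ) := by rw [ha, vol]; push_cast; rfl
  have hb' : b = ∑ i ∈ sᶜ, (G.degree i : ℝ) := by rw [hb, vol]; push_cast; rfl
  have hapos : 0 < a := ha' ▸ Finset.sum_pos (fun i _ => hG.degree_real_pos i) hs
  have hbpos : 0 < b := hb' ▸ Finset.sum_pos (fun i _ => hG.degree_real_pos i) hs'
  -- The two values make the degree-weighted mean vanish. The weighted square norm is `a * b * (a +
  -- b)` and the Laplacian form is `(a + b) ^ 2 * c`.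
  set y : V → ℝ := fun i => if i ∈ s then b else -a with hy
  have hsplit : ∀ f : ℝ → ℝ, ∑ i, (G.degree i : ℝ) * f (y i) = a * f b + b * f (-a) := by
    intro f
    have h1 : ∀ i ∈ s, (G.degree i : ℝ) * f (y i) = G.degree i * f b := fun i hi => by
      simp only [hy, if_pos hi]
    have h2 : ∀ i ∈ sᶜ, (G.degree i : ℝ) * f (y i) = G.degree i * f (-a) := fun i hi => by
      simp only [hy, if_neg (Finset.mem_compl.1 hi)]
    rw [← Finset.sum_add_sum_compl s, Finset.sum_congr rfl h1, Finset.sum_congr rfl h2,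
      ← Finset.sum_mul, ← Finset.sum_mul, ← ha', ← hb']
  have h0 : ∑ i, (G.degree i : ℝ) * y i = 0 := by
    rw [hsplit fun x => x]
    ring
  have hL : y ⬝ᵥ G.lapMatrix ℝ *ᵥ y = (a + b) ^ 2 * c := by
    rw [dotProduct_lapMatrix_mulVec]
    have h1 : ∀ i j, (if G.Adj i j then (y i - y j) ^ 2 else 0) =
        (a + b) ^ 2 * ((if i ∈ s ∧ j ∈ sᶜ ∧ G.Adj i j then 1 else 0) +
          (if j ∈ s ∧ i ∈ sᶜ ∧ G.Adj j i then 1 else 0)) := by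
      intro i j
      rw [hy]
      by_cases hij : G.Adj i j <;> by_cases hi : i ∈ s <;> by_cases hj : j ∈ s <;>
        simp [hij, hi, hj, G.adj_comm j i] <;> ring
    simp only [h1, ← Finset.mul_sum, Finset.sum_add_distrib]
    rw [Finset.sum_comm (f := fun i j => if j ∈ s ∧ i ∈ sᶜ ∧ G.Adj j i then (1 : ℝ) else 0),
      ← card_interedges_eq_sum]
    ring
  have h1 := hG.gap_mul_sum_le h0
  rw [hsplit fun x => x ^ 2, hL] at h1
  have h2 : (1 - G.omegaStar) * (a * b) ≤ (a + b) * c := by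
    have h3 : (a + b) * ((1 - G.omegaStar) * (a * b)) ≤ (a + b) * ((a + b) * c) := by
      linarith
    exact le_of_mul_le_mul_left h3 (by positivity)
  have hc0 : 0 ≤ c := Nat.cast_nonneg _
  rw [Nat.cast_min, ← ha, ← hb]
  rcases le_total a b with hab | hab
  · rw [min_eq_left hab]
    refine le_of_mul_le_mul_right ?_ hbpos
    nlinarith
  · rw [min_eq_right hab]
    refine le_of_mul_le_mul_right ?_ hapos
    nlinarith

lemma Connected.gap_le_two_mul_conductance [Nontrivial V] (hG : G.Connected) :
    1 - G.omegaStar ≤ 2 * G.conductance := by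
  obtain ⟨u, v, huv⟩ := exists_pair_ne V
  have : Nonempty {s : Finset V // s.Nonempty ∧ sᶜ.Nonempty} :=
    ⟨{u}, by simp, ⟨v, by simpa using huv.symm⟩⟩
  obtain ⟨⟨s, hs, hs'⟩, h⟩ := exists_eq_ciInf_of_finite
    (f := fun s : {s : Finset V // s.Nonempty ∧ sᶜ.Nonempty} =>
      ((G.interedges s.1 s.1ᶜ).card : ℝ) / (min (G.vol s.1) (G.vol s.1ᶜ) : ℕ))
  have hpos : ∀ t : Finset V, t.Nonempty → 0 < G.vol t := fun t ht =>
    Finset.sum_pos (fun i _ => hG.preconnected.degree_pos_of_nontrivial i) ht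
  have hmin : (0 : ℝ) < (min (G.vol s) (G.vol sᶜ) : ℕ) := by
    exact_mod_cast lt_min (hpos s hs) (hpos sᶜ hs')
  rw [conductance, ← h, ← mul_div_assoc, le_div_iff₀ hmin]
  exact hG.gap_mul_min_vol_le hs hs'

lemma dotProduct_lapMatrix_comm (x y : V → ℝ) :
    x ⬝ᵥ G.lapMatrix ℝ *ᵥ y = (G.lapMatrix ℝ *ᵥ x) ⬝ᵥ y := by
  rw [Matrix.dotProduct_mulVec, ← Matrix.mulVec_transpose, isSymm_lapMatrix]

lemma lapMatrix_mulVec_one : G.lapMatrix ℝ *ᵥ 1 = 0 := G.lapMatrix_mulVec_const_eq_zero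

lemma one_dotProduct_lapMatrix (x : V → ℝ) : 1 ⬝ᵥ G.lapMatrix ℝ *ᵥ x = 0 := by
  rw [dotProduct_lapMatrix_comm, lapMatrix_mulVec_one, zero_dotProduct]

/-- Evaluate the eigenvalue equation at a coordinate of largest modulus: both the diagonal term and
the neighbor sum are at most the degree times that modulus. -/
lemma lapMatrix_eigval_le {μ : ℝ} (hμ : (G.lapMatrix ℝ).IsEigval μ) : μ ≤ 2 * G.maxDegree := by
  obtain ⟨x, hx, hL⟩ := hμ
  obtain ⟨k, hk⟩ := Function.ne_iff.1 hx
  obtain ⟨i, -, hi⟩ := Finset.exists_max_image Finset.univ (fun i => |x i|) ⟨k, Finset.mem_univ k⟩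
  have hxi : 0 < |x i| := (abs_pos.2 hk).trans_le (hi k (Finset.mem_univ k))
  have h1 := congrFun hL i
  rw [lapMatrix_mulVec_apply, Pi.smul_apply, smul_eq_mul] at h1
  have h2 : |∑ u ∈ G.neighborFinset i, x u| ≤ G.degree i * |x i| := by
    refine (Finset.abs_sum_le_sum_abs _ _).trans ?_
    refine (Finset.sum_le_card_nsmul _ _ _ fun j _ => hi j (Finset.mem_univ j)).trans ?_
    rw [card_neighborFinset_eq_degree, nsmul_eq_mul]
  have h3 : |μ * x i| ≤ 2 * (G.degree i * |x i|) := by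
    rw [← h1]
    refine (abs_sub _ _).trans ?_
    rw [abs_mul, Nat.abs_cast]
    linarith
  rw [abs_mul] at h3
  have h4 : |μ| ≤ 2 * G.degree i := le_of_mul_le_mul_right (by linarith) hxi
  have h5 : (G.degree i : ℝ) ≤ G.maxDegree := by exact_mod_cast G.degree_le_maxDegree i
  linarith [le_abs_self μ]

lemma lapMatrix_eigval_nonneg {μ : ℝ} (hμ : (G.lapMatrix ℝ).IsEigval μ) : 0 ≤ μ := by
  obtain ⟨x, hx, hL⟩ := hμ
  have h1 := (posSemidef_lapMatrix ℝ G).dotProduct_mulVec_nonneg x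
  rw [hL, dotProduct_smul, star_trivial, smul_eq_mul] at h1
  have h2 : 0 < x ⬝ᵥ x := lt_of_le_of_ne (Finset.sum_nonneg fun i _ => mul_self_nonneg _)
    fun h => hx (dotProduct_self_eq_zero.1 h.symm)
  exact nonneg_of_mul_nonneg_left h1 h2

/-- The smallest and largest nonzero eigenvalues of the Laplacian. -/
lemma Connected.exists_lapMatrix_extreme [Nontrivial V] (hG : G.Connected) :
    ∃ l m : ℝ, 0 < l ∧ l ≤ m ∧ (G.lapMatrix ℝ).IsEigval l ∧ (G.lapMatrix ℝ).IsEigval m ∧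
      ∀ μ : ℝ, (G.lapMatrix ℝ).IsEigval μ → μ ≠ 0 → l ≤ μ ∧ μ ≤ m := by
  classical
  -- Otherwise the Laplacian form would be nonpositive, although a diagonal entry is a positive
  -- degree.
  have hne : ((G.lapMatrix ℝ).charpoly.roots.toFinset.erase 0).Nonempty := by
    by_contra hempty
    have h0 : ∀ μ : ℝ, (G.lapMatrix ℝ).IsEigval μ → μ ≤ 0 := by
      intro μ hμ
      by_contra hpos
      refine hempty ⟨μ, Finset.mem_erase.2 ⟨fun h => hpos h.le, ?_⟩⟩
      rwa [Multiset.mem_toFinset, ← Matrix.isEigval_iff_mem_roots]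
    obtain ⟨i⟩ := hG.nonempty
    have h1 := (G.isSymm_lapMatrix ℝ).dotProduct_mulVec_le (φ := 0) (c := 0) (b := 0)
      (z := Pi.single i 1) (by simp) (fun μ x hx _ hL => h0 μ ⟨x, hx, hL⟩) (by simp)
    rw [Matrix.mulVec_single_one, single_one_dotProduct] at h1
    have h2 : (G.lapMatrix ℝ).col i i = G.degree i := by
      simp [lapMatrix, degMatrix, Matrix.col]
    have := hG.degree_real_pos i
    rw [h2] at h1
    linarith
  obtain ⟨l, hl, hmin⟩ := Finset.exists_min_image _ id hne
  obtain ⟨m, hm, hmax⟩ := Finset.exists_max_image _ id hne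
  have hiff : ∀ μ, μ ∈ (G.lapMatrix ℝ).charpoly.roots.toFinset.erase 0 ↔
      μ ≠ 0 ∧ (G.lapMatrix ℝ).IsEigval μ := by
    intro μ
    rw [Finset.mem_erase, Multiset.mem_toFinset, Matrix.isEigval_iff_mem_roots]
  obtain ⟨hl0, hlE⟩ := (hiff l).1 hl
  exact ⟨l, m, lt_of_le_of_ne (lapMatrix_eigval_nonneg hlE) hl0.symm, hmin m hm, hlE,
    ((hiff m).1 hm).2, fun μ hμ hμ0 =>
      ⟨hmin μ ((hiff μ).2 ⟨hμ0, hμ⟩), hmax μ ((hiff μ).2 ⟨hμ0, hμ⟩)⟩⟩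

section Bounds

variable {l m : ℝ}

/-- A diagonal entry is a Rayleigh quotient; take it at a vertex of maximal degree. -/
lemma maxDegree_le_of_eigval_le [Nonempty V] (hm0 : 0 ≤ m)
    (hm : ∀ μ : ℝ, (G.lapMatrix ℝ).IsEigval μ → μ ≠ 0 → μ ≤ m) : (G.maxDegree : ℝ) ≤ m := by
  obtain ⟨i, hi⟩ := G.exists_maximal_degree_vertex
  have h1 := (G.isSymm_lapMatrix ℝ).dotProduct_mulVec_le (φ := 0) (c := 0) (b := m)
    (z := Pi.single i 1) (by simp) (fun μ x hx _ hL => by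
      by_cases h0 : μ = 0
      · rwa [h0]
      · exact hm μ ⟨x, hx, hL⟩ h0) (by simp)
  rw [Matrix.mulVec_single_one, single_one_dotProduct] at h1
  have h2 : (G.lapMatrix ℝ).col i i = G.degree i := by
    simp [lapMatrix, degMatrix, Matrix.col]
  rw [h2, ← hi] at h1
  simpa using h1

lemma Connected.mul_dotProduct_self_le (hG : G.Connected)
    (hl : ∀ μ : ℝ, (G.lapMatrix ℝ).IsEigval μ → μ ≠ 0 → l ≤ μ) {z : V → ℝ} (hz : z ⬝ᵥ 1 = 0) :
    l * (z ⬝ᵥ z) ≤ z ⬝ᵥ G.lapMatrix ℝ *ᵥ z := by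
  have h1 := (G.isSymm_lapMatrix ℝ).neg.dotProduct_mulVec_le (φ := 1) (c := 0) (b := -l)
    (z := z) (by rw [Matrix.neg_mulVec, lapMatrix_mulVec_one]; simp) (fun μ x hx hx1 hL => by
      have hL' : G.lapMatrix ℝ *ᵥ x = (-μ) • x := by
        rw [neg_smul, ← hL, Matrix.neg_mulVec, neg_neg]
      have := hl (-μ) ⟨x, hx, hL'⟩ fun h0 => by
        rw [h0, zero_smul] at hL'
        obtain ⟨c, rfl⟩ := hG.exists_eq_const hL'
        obtain ⟨i⟩ := hG.nonempty
        have hcard : (Fintype.card V : ℝ) ≠ 0 := by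
          exact_mod_cast (Fintype.card_pos_iff.2 ⟨i⟩).ne'
        rw [smul_dotProduct, one_dotProduct_one, smul_eq_mul] at hx1
        exact hx (by rw [(mul_eq_zero.1 hx1).resolve_right hcard, zero_smul])
      linarith) hz
  rw [Matrix.neg_mulVec, dotProduct_neg] at h1
  linarith

/-- Shift the Laplacian eigenvector to degree-weighted mean zero and use it as a test vector for the
walk's gap. The shift does not change the Laplacian form, and it can only increase the unweighted
norm because the eigenvector sums to zero. -/
lemma Connected.minDegree_mul_gap_le [Nontrivial V] (hG : G.Connected) (hl0 : 0 < l)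
    (hl : (G.lapMatrix ℝ).IsEigval l) : (G.minDegree : ℝ) * (1 - G.omegaStar) ≤ l := by
  obtain ⟨y, hy, hL⟩ := hl
  have hδ : 0 < 1 - G.omegaStar := sub_pos.2 hG.omegaStar_spec.2.1
  have hvol : 0 < ∑ i, (G.degree i : ℝ) :=
    Finset.sum_pos (fun i _ => hG.degree_real_pos i) ⟨_, Finset.mem_univ hG.nonempty.some⟩
  set c : ℝ := (∑ i, (G.degree i : ℝ) * y i) / ∑ i, (G.degree i : ℝ) with hc
  have hsum : ∑ i, y i = 0 := by
    have h1 := one_dotProduct_lapMatrix (G := G) y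
    rw [hL, dotProduct_smul, one_dotProduct, smul_eq_mul] at h1
    exact (mul_eq_zero.1 h1).resolve_left hl0.ne'
  have h0 : ∑ i, (G.degree i : ℝ) * (y i - c) = 0 := by
    simp only [mul_sub, Finset.sum_sub_distrib, ← Finset.sum_mul]
    rw [hc, mul_div_cancel₀ _ hvol.ne', sub_self]
  have h1 := hG.gap_mul_sum_le h0
  have hyc : (fun i => y i - c) = y - c • (1 : V → ℝ) := by ext i; simp
  have h2 : (fun i => y i - c) ⬝ᵥ G.lapMatrix ℝ *ᵥ (fun i => y i - c) = l * ∑ i, y i ^ 2 := by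
    rw [hyc, Matrix.mulVec_sub, Matrix.mulVec_smul, lapMatrix_mulVec_one, smul_zero, sub_zero, hL,
      dotProduct_smul, sub_dotProduct, smul_dotProduct, one_dotProduct, hsum, smul_zero, sub_zero,
      smul_eq_mul, dotProduct]
    simp only [sq]
  rw [h2] at h1
  have h3 := sum_sq_shift (fun _ => 1) y c (by simpa using hsum)
  simp only [one_mul] at h3
  have hypos : 0 < ∑ i, y i ^ 2 := by
    obtain ⟨k, hk⟩ := Function.ne_iff.1 hy
    have hk : y k ≠ 0 := hk
    exact Finset.sum_pos' (fun i _ => sq_nonneg _) ⟨k, Finset.mem_univ k, by positivity⟩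
  have h4 : ∑ i, y i ^ 2 ≤ ∑ i, (y i - c) ^ 2 := by
    rw [h3]
    have : (0 : ℝ) ≤ ∑ _i : V, (1 : ℝ) := Finset.sum_nonneg fun _ _ => zero_le_one
    nlinarith [sq_nonneg c]
  have h5 : (G.minDegree : ℝ) * ∑ i, (y i - c) ^ 2 ≤ ∑ i, (G.degree i : ℝ) * (y i - c) ^ 2 := by
    rw [Finset.mul_sum]
    refine Finset.sum_le_sum fun i _ => mul_le_mul_of_nonneg_right ?_ (sq_nonneg _)
    exact_mod_cast G.minDegree_le_degree i
  refine le_of_mul_le_mul_right ?_ (hypos.trans_le h4)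
  calc (G.minDegree : ℝ) * (1 - G.omegaStar) * ∑ i, (y i - c) ^ 2
      = (1 - G.omegaStar) * ((G.minDegree : ℝ) * ∑ i, (y i - c) ^ 2) := by ring
    _ ≤ (1 - G.omegaStar) * ∑ i, (G.degree i : ℝ) * (y i - c) ^ 2 :=
        mul_le_mul_of_nonneg_left h5 hδ.le
    _ ≤ l * ∑ i, y i ^ 2 := h1
    _ ≤ l * ∑ i, (y i - c) ^ 2 := mul_le_mul_of_nonneg_left h4 hl0.le

/-- The mirror argument: an eigenvector `v` for `ω*` satisfies `L v = (1 - ω*) 𝒟 v`, so it has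
weighted mean zero; shifted to plain mean zero it is a test vector for the Laplacian. -/
lemma Connected.le_maxDegree_mul_gap [Nontrivial V] (hG : G.Connected)
    (hl : ∀ μ : ℝ, (G.lapMatrix ℝ).IsEigval μ → μ ≠ 0 → l ≤ μ) :
    l ≤ G.maxDegree * (1 - G.omegaStar) := by
  obtain ⟨⟨v, hv, hW⟩, hω1, -⟩ := hG.omegaStar_spec
  have hδ : 0 < 1 - G.omegaStar := sub_pos.2 hω1
  rw [hG.walkMatrix_mulVec_eq_iff] at hW
  have hL : G.lapMatrix ℝ *ᵥ v = fun i => (1 - G.omegaStar) * (G.degree i * v i) := by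
    ext i
    rw [lapMatrix, Matrix.sub_mulVec, Pi.sub_apply, degMatrix_mulVec_apply, hW]
    ring
  have hsum : ∑ i, (G.degree i : ℝ) * v i = 0 := by
    have h1 := one_dotProduct_lapMatrix (G := G) v
    rw [hL, one_dotProduct, ← Finset.mul_sum] at h1
    exact (mul_eq_zero.1 h1).resolve_left hδ.ne'
  have hcard : (Fintype.card V : ℝ) ≠ 0 := by
    exact_mod_cast (Fintype.card_pos_iff.2 hG.nonempty).ne'
  have hvol : 0 < ∑ i, (G.degree i : ℝ) :=
    Finset.sum_pos (fun i _ => hG.degree_real_pos i) ⟨_, Finset.mem_univ hG.nonempty.some⟩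
  set c : ℝ := (∑ i, v i) / Fintype.card V with hc
  have hvc : (fun i => v i - c) = v - c • (1 : V → ℝ) := by ext i; simp
  have h0 : (fun i => v i - c) ⬝ᵥ 1 = 0 := by
    rw [dotProduct_one, Finset.sum_sub_distrib, Finset.sum_const, Finset.card_univ, nsmul_eq_mul,
      hc, mul_div_cancel₀ _ hcard, sub_self]
  have h1 := hG.mul_dotProduct_self_le hl h0
  have h2 : (fun i => v i - c) ⬝ᵥ G.lapMatrix ℝ *ᵥ (fun i => v i - c) =
      (1 - G.omegaStar) * ∑ i, (G.degree i : ℝ) * v i ^ 2 := by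
    rw [hvc, Matrix.mulVec_sub, Matrix.mulVec_smul, lapMatrix_mulVec_one, smul_zero, sub_zero,
      sub_dotProduct, smul_dotProduct, one_dotProduct_lapMatrix, smul_zero, sub_zero, hL,
      dotProduct, Finset.mul_sum]
    exact Finset.sum_congr rfl fun i _ => by ring
  have h3 := sum_sq_shift (fun i => (G.degree i : ℝ)) v c hsum
  have h4 : (fun i => v i - c) ⬝ᵥ (fun i => v i - c) = ∑ i, (v i - c) ^ 2 := by
    simp only [dotProduct, sq]
  rw [h2, h4] at h1
  have hpos : 0 < ∑ i, (v i - c) ^ 2 := by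
    refine lt_of_le_of_ne (Finset.sum_nonneg fun i _ => sq_nonneg _) fun h => hv ?_
    have h5 : ∀ i, v i = c := by
      intro i
      have := (Finset.sum_eq_zero_iff_of_nonneg fun i _ => sq_nonneg (v i - c)).1 h.symm i
        (Finset.mem_univ i)
      exact sub_eq_zero.1 (pow_eq_zero_iff two_ne_zero |>.1 this)
    simp only [h5, ← Finset.sum_mul] at hsum
    ext i
    rw [h5, (mul_eq_zero.1 hsum).resolve_left hvol.ne', Pi.zero_apply]
  refine le_of_mul_le_mul_right ?_ hpos
  calc l * ∑ i, (v i - c) ^ 2 ≤ (1 - G.omegaStar) * ∑ i, (G.degree i : ℝ) * v i ^ 2 := h1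
    _ ≤ (1 - G.omegaStar) * ∑ i, (G.degree i : ℝ) * (v i - c) ^ 2 := by
        refine mul_le_mul_of_nonneg_left ?_ hδ.le
        rw [h3]
        nlinarith [sq_nonneg c]
    _ ≤ (1 - G.omegaStar) * ∑ i, (G.maxDegree : ℝ) * (v i - c) ^ 2 := by
        refine mul_le_mul_of_nonneg_left (Finset.sum_le_sum fun i _ =>
          mul_le_mul_of_nonneg_right ?_ (sq_nonneg _)) hδ.le
        exact_mod_cast G.degree_le_maxDegree i
    _ = G.maxDegree * (1 - G.omegaStar) * ∑ i, (v i - c) ^ 2 := by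
        rw [← Finset.mul_sum]
        ring

end Bounds

/-! ### The optimal rate of gradient descent. -/

section GradientDescent

variable {α : ℝ}

lemma gdMatrix_mulVec (x : V → ℝ) : G.gdMatrix α *ᵥ x = x - α • (G.lapMatrix ℝ *ᵥ x) := by
  rw [gdMatrix, Matrix.sub_mulVec, Matrix.one_mulVec, Matrix.smul_mulVec]

lemma isSymm_gdMatrix : (G.gdMatrix α).IsSymm := by
  rw [Matrix.IsSymm, gdMatrix, Matrix.transpose_sub, Matrix.transpose_one, Matrix.transpose_smul,
    isSymm_lapMatrix]

lemma Connected.fixesConst_gdMatrix (hG : G.Connected) (hα : α ≠ 0) :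
    (G.gdMatrix α).FixesConst 1 where
  right := by rw [gdMatrix_mulVec, lapMatrix_mulVec_one, smul_zero, sub_zero]
  left := by
    rw [← Matrix.mulVec_transpose, isSymm_gdMatrix, gdMatrix_mulVec, lapMatrix_mulVec_one,
      smul_zero, sub_zero]
  ne := by
    rw [one_dotProduct_one]
    exact_mod_cast (Fintype.card_pos_iff.2 hG.nonempty).ne'
  const x hx := by
    rw [gdMatrix_mulVec, sub_eq_self, smul_eq_zero] at hx
    exact hG.exists_eq_const (hx.resolve_left hα)

lemma isEigval_gdMatrix {l : ℝ} (hl : (G.lapMatrix ℝ).IsEigval l) :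
    (G.gdMatrix α).IsEigval (1 - α * l) := by
  obtain ⟨x, hx, hL⟩ := hl
  exact ⟨x, hx, by rw [gdMatrix_mulVec, hL, smul_smul, sub_smul, one_smul]⟩

lemma exists_of_isEigval_gdMatrix (hα : α ≠ 0) {μ : ℂ}
    (hμ : (G.gdMatrix α).toComplex.IsEigval μ) :
    ∃ l : ℝ, (G.lapMatrix ℝ).IsEigval l ∧ μ = (1 - α * l : ℝ) := by
  obtain ⟨ω, rfl, x, hx, hT⟩ := hμ.exists_real (Matrix.IsHermitian.splits_charpoly (by
    rw [Matrix.IsHermitian, Matrix.conjTranspose_eq_transpose_of_trivial, isSymm_gdMatrix]))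
  refine ⟨(1 - ω) / α, ⟨x, hx, ?_⟩, by rw [mul_div_cancel₀ _ hα, sub_sub_cancel]⟩
  rw [gdMatrix_mulVec] at hT
  have h1 : α • (G.lapMatrix ℝ *ᵥ x) = (1 - ω) • x := by
    rw [sub_smul, one_smul, ← hT, sub_sub_cancel]
  rw [div_eq_inv_mul, ← smul_smul, ← h1, smul_smul, inv_mul_cancel₀ hα, one_smul]

lemma Connected.isOptimalGDRate (hG : G.Connected) {l m : ℝ} (hl0 : 0 < l) (hlm : l ≤ m)
    (hl : (G.lapMatrix ℝ).IsEigval l) (hm : (G.lapMatrix ℝ).IsEigval m)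
    (hlm' : ∀ μ : ℝ, (G.lapMatrix ℝ).IsEigval μ → μ ≠ 0 → l ≤ μ ∧ μ ≤ m) :
    G.IsOptimalGDRate ((m - l) / (m + l)) := by
  have hsum : 0 < m + l := by linarith
  set τ := (m - l) / (m + l) with hτ
  have hτ0 : 0 ≤ τ := div_nonneg (by linarith) hsum.le
  have hτ1 : τ < 1 := by rw [hτ, div_lt_one hsum]; linarith
  have hα0 : 0 < 2 / (m + l) := by positivity
  have hF := hG.fixesConst_gdMatrix hα0.ne'
  have hle : ∀ μ : ℂ, (G.gdMatrix (2 / (m + l))).toComplex.IsEigval μ → μ ≠ 1 → ‖μ‖ ≤ τ := by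
    intro μ hμ hμ1
    obtain ⟨x, hx, rfl⟩ := exists_of_isEigval_gdMatrix hα0.ne' hμ
    have hx0 : x ≠ 0 := by
      rintro rfl
      simp at hμ1
    obtain ⟨h1, h2⟩ := hlm' x hx hx0
    rw [Complex.norm_real, Real.norm_eq_abs, abs_le, hτ]
    constructor
    · rw [← neg_div, div_le_iff₀ hsum]
      field_simp
      linarith
    · rw [le_div_iff₀ hsum]
      field_simp
      linarith
  have hex : ∃ μ : ℂ, (G.gdMatrix (2 / (m + l))).toComplex.IsEigval μ ∧ μ ≠ 1 ∧ ‖μ‖ = τ := by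
    have hval : 1 - 2 / (m + l) * l = τ := by
      rw [hτ]
      field_simp
      ring
    refine ⟨_, (isEigval_gdMatrix (α := 2 / (m + l)) hl).toComplex, ?_, ?_⟩
    · rw [hval]
      exact_mod_cast hτ1.ne
    · rw [hval, Complex.norm_real, Real.norm_of_nonneg hτ0]
  have hlow : ∀ α : ℝ, 0 < α → ∀ r : ℝ,
      (∀ μ : ℂ, (G.gdMatrix α).toComplex.IsEigval μ → μ ≠ 1 → ‖μ‖ ≤ r) → τ ≤ r := by
    intro α hα r hr
    have key : ∀ x : ℝ, 0 < x → (G.lapMatrix ℝ).IsEigval x → |1 - α * x| ≤ r := by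
      intro x hx0 hx
      have := hr _ (isEigval_gdMatrix (α := α) hx).toComplex (by
        have : 1 - α * x ≠ 1 := by
          have := mul_pos hα hx0
          intro h
          linarith
        exact_mod_cast this)
      rwa [Complex.norm_real, Real.norm_eq_abs] at this
    have h1 := (le_abs_self _).trans (key l hl0 hl)
    have h2 := (neg_abs_le _).trans' (neg_le_neg (key m (hl0.trans_le hlm) hm))
    rw [hτ, div_le_iff₀ hsum]
    -- Weighting the bounds at `l` and `m` by `m` and `l` cancels the terms in `α`.
    have h3 := mul_le_mul_of_nonneg_left h1 (hl0.le.trans hlm)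
    have h4 := mul_le_mul_of_nonneg_left h2 hl0.le
    linarith
  refine ⟨⟨⟨_, hα0, hF.isConvergenceRate hle hex hτ1⟩, ?_⟩,
    ⟨⟨_, hα0, (hF.absLambdaTwo_eq hle hex hτ1.le).symm⟩, ?_⟩⟩
  · rintro r ⟨α, hα, hr⟩
    exact hlow α hα r fun μ hμ hμ1 => hr.norm_le hμ hμ1
  · rintro r ⟨α, hα, rfl⟩
    by_contra hlt
    push Not at hlt
    refine absurd (hlow α hα _ fun μ hμ hμ1 => ?_) (not_le.2 hlt)
    -- The alternative `1 ≤ |λ₂|` is excluded, since `|λ₂| < τ < 1` was assumed.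
    rcases min_le_iff.1 ((hG.fixesConst_gdMatrix hα.ne').min_le_absLambdaTwo hμ hμ1) with h | h
    · linarith
    · exact h

end GradientDescent

end SimpleGraph

/-! ### Operators on darts and their relation to the random walk. -/

namespace SimpleGraph

open Matrix

lemma HasEvenCycle.nontrivial {V : Type*} {G : SimpleGraph V} (h : G.HasEvenCycle) : Nontrivial V := by
  obtain ⟨v, c, hc, -⟩ := h
  cases c with
  | nil => exact absurd rfl hc.ne_nil
  | cons h q => exact ⟨_, _, h.ne⟩

section DartOperators

variable {V : Type*} [Fintype V] [DecidableEq V] (G : SimpleGraph V) [DecidableRel G.Adj]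
variable (K : Type*) [Field K]

/-- The permutation matrix of the reversal of darts. -/
def dartFlip : Matrix G.Dart G.Dart K := Matrix.of fun d d' => if d' = d.symm then 1 else 0

/-- The matrix averaging over the darts that leave the same vertex. -/
def dartAvg : Matrix G.Dart G.Dart K :=
  Matrix.of fun d d' => if d'.fst = d.fst then (G.degree d.fst : K)⁻¹ else 0

/-- The common form of the ADMM matrix over an arbitrary field. -/
def dartOp (a c p : K) : Matrix G.Dart G.Dart K :=
  a • 1 + c • (((2 : K) • G.dartAvg K - 1) * (G.dartFlip K + p • 1))

variable {K}

/-- The average of `x` over the darts leaving `i`. -/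
def outAvg (x : G.Dart → K) (i : V) : K :=
  (G.degree i : K)⁻¹ * ∑ d : G.Dart, if d.fst = i then x d else 0

/-- The random walk operator. -/
def walkAvg (v : V → K) (i : V) : K := (G.degree i : K)⁻¹ * ∑ u ∈ G.neighborFinset i, v u

variable {G}

lemma sum_dart_fst (f : V → K) (i : V) :
    (∑ d : G.Dart, if d.fst = i then f d.snd else 0) = ∑ u ∈ G.neighborFinset i, f u := by
  rw [← Finset.sum_filter]
  refine Finset.sum_bij' (fun d _ => d.snd)
    (fun u hu => ⟨(i, u), (G.mem_neighborFinset i u).1 hu⟩) ?_ ?_ ?_ ?_ ?_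
  · intro d hd
    rw [mem_neighborFinset, ← (Finset.mem_filter.1 hd).2]
    exact d.adj
  · intro u hu
    simp
  · intro d hd
    ext
    · exact (Finset.mem_filter.1 hd).2.symm
    · rfl
  · intro u hu
    rfl
  · intro d hd
    rfl

lemma sum_dart_fst_const (c : K) (i : V) :
    (∑ d : G.Dart, if d.fst = i then c else 0) = G.degree i * c := by
  rw [sum_dart_fst fun _ => c, Finset.sum_const, card_neighborFinset_eq_degree, nsmul_eq_mul]

lemma dartFlip_mulVec (x : G.Dart → K) : G.dartFlip K *ᵥ x = fun d => x d.symm := by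
  ext d
  simp [dartFlip, Matrix.mulVec, dotProduct]

lemma dartAvg_mulVec (x : G.Dart → K) : G.dartAvg K *ᵥ x = fun d => G.outAvg x d.fst := by
  ext d
  simp [dartAvg, outAvg, Matrix.mulVec, dotProduct, Finset.mul_sum]

lemma dartOp_mulVec (a c p : K) (x : G.Dart → K) :
    G.dartOp K a c p *ᵥ x = fun d => a * x d + c *
      (2 * G.outAvg (fun e => x e.symm + p * x e) d.fst - (x d.symm + p * x d)) := by
  have h : (G.dartFlip K + p • 1) *ᵥ x = fun e => x e.symm + p * x e := by
    rw [Matrix.add_mulVec, Matrix.smul_mulVec, Matrix.one_mulVec, dartFlip_mulVec]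
    rfl
  rw [dartOp, Matrix.add_mulVec, Matrix.smul_mulVec, Matrix.one_mulVec, Matrix.smul_mulVec,
    ← Matrix.mulVec_mulVec, h, Matrix.sub_mulVec, Matrix.smul_mulVec, Matrix.one_mulVec,
    dartAvg_mulVec]
  rfl

lemma outAvg_add (x y : G.Dart → K) (i : V) :
    G.outAvg (fun d => x d + y d) i = G.outAvg x i + G.outAvg y i := by
  rw [outAvg, outAvg, outAvg, ← mul_add, ← Finset.sum_add_distrib]
  congr 1
  exact Finset.sum_congr rfl fun d _ => by split_ifs <;> simp

lemma outAvg_mul (c : K) (x : G.Dart → K) (i : V) :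
    G.outAvg (fun d => c * x d) i = c * G.outAvg x i := by
  rw [outAvg, outAvg, mul_left_comm c]
  congr 1
  rw [Finset.mul_sum]
  exact Finset.sum_congr rfl fun d _ => by split_ifs <;> simp

lemma outAvg_snd (v : V → K) (i : V) : G.outAvg (fun d => v d.snd) i = G.walkAvg v i := by
  rw [outAvg, walkAvg, sum_dart_fst]

lemma outAvg_fst [CharZero K] [Nontrivial V] (hG : G.Connected) (v : V → K) (i : V) :
    G.outAvg (fun d => v d.fst) i = v i := by
  have h1 : ∀ d : G.Dart, (if d.fst = i then v d.fst else 0) = if d.fst = i then v i else 0 := by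
    intro d
    split_ifs with h
    · rw [h]
    · rfl
  have h2 : (G.degree i : K) ≠ 0 := by
    exact_mod_cast (hG.preconnected.degree_pos_of_nontrivial i).ne'
  rw [outAvg, Finset.sum_congr rfl fun d _ => h1 d, sum_dart_fst_const, inv_mul_cancel_left₀ h2]

section Spectrum

variable [CharZero K] [Nontrivial V] (hG : G.Connected) {p u : K} {x : G.Dart → K}
include hG

/-- The averages of an eigenvector of the ADMM matrix are eigenvectors of the random walk. -/
lemma Connected.walkAvg_outAvg
    (hx : ∀ d, 2 * G.outAvg (fun e => x e.symm + p * x e) d.fst - (x d.symm + p * x d) = u * x d) :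
    (∀ d, ((p + u) ^ 2 - 1) * x d =
      2 * u * ((p + u) * G.outAvg x d.fst - G.outAvg x d.snd)) ∧
    ∀ i, 2 * u * G.walkAvg (G.outAvg x) i = (u ^ 2 - p ^ 2 + 1) * G.outAvg x i := by
  set z : V → K := G.outAvg fun e => x e.symm + p * x e with hz
  -- Average the eigenvalue equation over the darts leaving `i`; the averaging B satisfies `B(2B -
  -- 1) = B`.
  have hzw : ∀ i, z i = u * G.outAvg x i := by
    intro i
    have h1 : (fun d : G.Dart => u * x d) =
        fun d => (2 * z d.fst) + (-1) * (x d.symm + p * x d) := by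
      ext d
      rw [← hx d]
      ring
    have h2 := outAvg_mul u x i
    rw [h1, outAvg_add, outAvg_mul, outAvg_fst hG z, outAvg_mul, ← hz] at h2
    rw [← h2]
    ring
  have hA : ∀ d, x d.symm = 2 * (u * G.outAvg x d.fst) - (p + u) * x d := by
    intro d
    have := hx d
    rw [hzw] at this
    linear_combination -this
  -- Using `hA` at `d` and at `d.symm` eliminates the reversed value and expresses `x` through its
  -- vertex averages. Averaging this once more gives the second claim.
  have hB : ∀ d, ((p + u) ^ 2 - 1) * x d =
      2 * u * ((p + u) * G.outAvg x d.fst - G.outAvg x d.snd) := by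
    intro d
    have h1 := hA d
    have h2 := hA d.symm
    rw [Dart.symm_symm, Dart.symm_toProd] at h2
    simp only [Prod.fst_swap] at h2
    rw [h1] at h2
    linear_combination -h2
  refine ⟨hB, fun i => ?_⟩
  have h1 : (fun d : G.Dart => ((p + u) ^ 2 - 1) * x d) =
      fun d => (2 * u * (p + u) * G.outAvg x d.fst) + (-(2 * u)) * G.outAvg x d.snd := by
    ext d
    rw [hB d]
    ring
  have h2 := outAvg_mul ((p + u) ^ 2 - 1) x i
  rw [h1, outAvg_add, outAvg_mul, outAvg_fst hG (G.outAvg x), outAvg_mul,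
    outAvg_snd] at h2
  linear_combination -h2

/-- Eigenvectors of the random walk lift to eigenvectors of the ADMM matrix. -/
lemma Connected.dartOp_lift {v : V → K} {ω : K} (hv : ∀ i, G.walkAvg v i = ω * v i)
    (hu : u ^ 2 - 2 * ω * u + 1 - p ^ 2 = 0) (a c : K) :
    G.dartOp K a c p *ᵥ (fun d => (p + u) * v d.fst - v d.snd) =
      (a + c * u) • fun d => (p + u) * v d.fst - v d.snd := by
  -- Up to a scalar, the lift is the form forced on eigenvectors by the first conclusion of
  -- `Connected.walkAvg_outAvg`.
  rw [dartOp_mulVec]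
  ext d
  have h1 : (fun e : G.Dart => ((p + u) * v e.symm.fst - v e.symm.snd) +
      p * ((p + u) * v e.fst - v e.snd)) =
      fun e => (p * (p + u) - 1) * v e.fst + u * v e.snd := by
    ext e
    simp only [Dart.symm_toProd, Prod.fst_swap, Prod.snd_swap]
    ring
  rw [h1, outAvg_add, outAvg_mul, outAvg_fst hG (fun j => v j), outAvg_mul, outAvg_snd, hv]
  simp only [Dart.symm_toProd, Prod.fst_swap, Prod.snd_swap, Pi.smul_apply, smul_eq_mul]
  linear_combination (-(c * v d.fst)) * hu

/-- If the lift vanished, every step along an edge would multiply `v` by `t`. Averaging gives `t =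
ω`, and crossing an edge back and forth at a vertex with `v ≠ 0` gives `ω ^ 2 = 1`. -/
lemma Connected.lift_ne_zero {v : V → K} (hv0 : v ≠ 0) {ω : K}
    (hv : ∀ i, G.walkAvg v i = ω * v i) (hω : ω ^ 2 ≠ 1) (t : K) :
    (fun d : G.Dart => t * v d.fst - v d.snd) ≠ 0 := by
  intro h
  have h1 : ∀ d : G.Dart, v d.snd = t * v d.fst := fun d =>
    (sub_eq_zero.1 (congrFun h d)).symm
  obtain ⟨i, hi⟩ := Function.ne_iff.1 hv0
  have hi : v i ≠ 0 := hi
  have htω : t = ω := by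
    have h2 := hv i
    rw [← outAvg_snd] at h2
    simp only [h1] at h2
    rw [outAvg_mul, outAvg_fst hG v] at h2
    exact mul_right_cancel₀ hi h2
  obtain ⟨j, hj⟩ : ∃ j, G.Adj i j := by
    rw [← G.degree_pos_iff_exists_adj]
    exact hG.preconnected.degree_pos_of_nontrivial i
  have h2 := h1 ⟨(i, j), hj⟩
  have h3 := h1 ⟨(j, i), hj.symm⟩
  simp only at h2 h3
  rw [h2, ← mul_assoc] at h3
  refine hω ?_
  rw [← htω, sq]
  exact mul_right_cancel₀ hi (by rw [← h3, one_mul])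

end Spectrum

end DartOperators

/-! ### The alternating vector of an even cycle. -/

section EvenCycle

variable {V : Type*} [DecidableEq V] {G : SimpleGraph V}

/-- The alternating sum of the indicators of the edges of a walk. -/
def Walk.altSum : {u v : V} → G.Walk u v → G.Dart → ℝ
  | _, _, .nil, _ => 0
  | _, _, .cons (u := u) (v := w) _ q, d => (if d.edge = s(u, w) then 1 else 0) - altSum q d

lemma Walk.altSum_symm {u v : V} (q : G.Walk u v) (d : G.Dart) : q.altSum d.symm = q.altSum d := by
  induction q with
  | nil => rfl
  | cons h q ih => simp only [altSum, ih, Dart.edge_symm]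

lemma Walk.altSum_eq_zero {u v : V} (q : G.Walk u v) (d : G.Dart) (hd : d.edge ∉ q.edges) :
    q.altSum d = 0 := by
  induction q with
  | nil => rfl
  | cons h q ih =>
    rw [edges_cons, List.mem_cons, not_or] at hd
    rw [altSum, if_neg hd.1, ih hd.2, sub_zero]

/-- Telescoping: consecutive edges contribute with opposite signs at their common vertex, so only
the ends survive. On a closed walk of even length these cancel too. -/
lemma Walk.sum_altSum [Fintype V] [DecidableRel G.Adj] {u v : V} (q : G.Walk u v) (i : V) :
    (∑ d : G.Dart, if d.fst = i then q.altSum d else 0) =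
      (if i = u then 1 else 0) - (-1) ^ q.length * (if i = v then 1 else 0) := by
  induction q with
  | nil => simp [altSum]
  | cons h q ih =>
    rename_i u w v
    have h1 : ∀ d : G.Dart, (if d.fst = i then (Walk.cons h q).altSum d else 0) =
        (if d.fst = i then (if d.edge = s(u, w) then (1 : ℝ) else 0) else 0) -
          if d.fst = i then q.altSum d else 0 := by
      intro d
      split_ifs <;> simp_all [altSum]
    have h2 : (∑ d : G.Dart, if d.fst = i then (if d.edge = s(u, w) then (1 : ℝ) else 0) else 0) =
        (if i = u then 1 else 0) + if i = w then 1 else 0 := by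
      have h3 : ∀ d : G.Dart, (if d.fst = i then (if d.edge = s(u, w) then (1 : ℝ) else 0) else 0) =
          (if d = ⟨(u, w), h⟩ then (if i = u then 1 else 0) else 0) +
          if d = (⟨(u, w), h⟩ : G.Dart).symm then (if i = w then 1 else 0) else 0 := by
        intro d
        have h4 := dart_edge_eq_iff d ⟨(u, w), h⟩
        have h5 : (⟨(u, w), h⟩ : G.Dart) ≠ (⟨(u, w), h⟩ : G.Dart).symm := (Dart.symm_ne _).symm
        have h6 : (⟨(u, w), h⟩ : G.Dart).edge = s(u, w) := rfl
        rw [h6] at h4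
        by_cases ha : d = ⟨(u, w), h⟩
        · subst ha
          simp [h.ne, eq_comm]
        · by_cases hb : d = (⟨(u, w), h⟩ : G.Dart).symm
          · subst hb
            simp [Dart.symm, h.ne, eq_comm]
          · rw [if_neg ha, if_neg hb, if_neg (h4.not.2 (not_or.2 ⟨ha, hb⟩))]
            simp
      simp only [h3, Finset.sum_add_distrib, Finset.sum_ite_eq', Finset.mem_univ, if_true]
    simp only [h1, Finset.sum_sub_distrib, h2, ih, length_cons, pow_succ]
    ring

lemma HasEvenCycle.exists_alternating [Fintype V] [DecidableRel G.Adj] (h : G.HasEvenCycle) :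
    ∃ f : G.Dart → ℝ, f ≠ 0 ∧ (∀ d, f d.symm = f d) ∧
      ∀ i, (∑ d : G.Dart, if d.fst = i then f d else 0) = 0 := by
  obtain ⟨v, c, hc, heven⟩ := h
  refine ⟨c.altSum, ?_, c.altSum_symm, fun i => ?_⟩
  · cases c with
    | nil => exact absurd rfl hc.ne_nil
    | cons h q =>
      rename_i w
      intro h0
      have h1 := congrFun h0 ⟨(v, w), h⟩
      -- A cycle does not repeat its first edge, so the alternating sum is 1 there.
      have h2 : (⟨(v, w), h⟩ : G.Dart).edge ∉ q.edges := by
        have := hc.edges_nodup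
        rw [Walk.edges_cons, List.nodup_cons] at this
        exact this.1
      rw [Walk.altSum, Walk.altSum_eq_zero q _ h2] at h1
      simp [Dart.edge] at h1
  · rw [Walk.sum_altSum, heven.neg_one_pow, one_mul, sub_self]

end EvenCycle

end SimpleGraph

/-! ### The ADMM matrix in terms of dart operators, and its eigenvalues. -/

namespace SimpleGraph

open Matrix

variable {V : Type*} [DecidableEq V] {G : SimpleGraph V}

lemma admmQ_eq : G.admmQ = 1 - G.dartFlip ℝ := by
  ext d d'
  rw [admmQ, dartFlip, Matrix.sub_apply, Matrix.of_apply, Matrix.of_apply, Matrix.one_apply]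
  have h1 := dart_edge_eq_iff d d'
  have h2 : d = d'.symm ↔ d' = d.symm :=
    ⟨fun h => by rw [h, Dart.symm_symm], fun h => by rw [h, Dart.symm_symm]⟩
  by_cases h : d = d'
  · subst h
    simp [(Dart.symm_ne d).symm]
  · by_cases h' : d' = d.symm
    · rw [if_pos (h1.2 (Or.inr (h2.2 h'))), if_neg h, if_neg h, if_pos h', zero_sub]
    · rw [if_neg (h1.not.2 (not_or.2 ⟨h, h2.not.2 h'⟩)), if_neg h,
        if_neg h', sub_zero]

lemma transpose_dartFlip : (G.dartFlip ℝ).transpose = G.dartFlip ℝ := by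
  ext d d'
  have h2 : d = d'.symm ↔ d' = d.symm :=
    ⟨fun h => by rw [h, Dart.symm_symm], fun h => by rw [h, Dart.symm_symm]⟩
  simp only [dartFlip, Matrix.transpose_apply, Matrix.of_apply, h2]

variable [Fintype V] [DecidableRel G.Adj]

lemma dartFlip_mul_self : G.dartFlip ℝ * G.dartFlip ℝ = 1 := by
  ext d d'
  rw [Matrix.mul_apply]
  simp only [dartFlip, Matrix.of_apply, ite_mul, one_mul, zero_mul, Finset.sum_ite_eq',
    Finset.mem_univ, if_true, Dart.symm_symm, Matrix.one_apply, eq_comm]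

/-- Reversal F is an involution and `Q = 1 - F`, so the inverse lies in the span of 1 and F. -/
lemma admmA_eq {ρ : ℝ} (hρ : 0 < ρ) :
    G.admmA ρ = (ρ + 2)⁻¹ • ((ρ + 1) • (1 : Matrix G.Dart G.Dart ℝ) + G.dartFlip ℝ) := by
  refine Matrix.inv_eq_right_inv ?_
  rw [admmQ_eq]
  have h2 : ρ + 2 ≠ 0 := by positivity
  rw [Matrix.mul_smul, add_mul, one_mul, Matrix.smul_mul, sub_mul, one_mul, mul_add, Matrix.mul_smul,
    mul_one, dartFlip_mul_self]
  ext d d'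
  simp only [Matrix.add_apply, Matrix.sub_apply, Matrix.smul_apply, smul_eq_mul]
  field_simp
  ring

lemma Connected.admmB_eq [Nontrivial V] (hG : G.Connected) : G.admmB = G.dartAvg ℝ := by
  have hS : G.admmS.transpose * G.admmS = Matrix.diagonal fun i => (G.degree i : ℝ) := by
    ext i j
    rw [Matrix.mul_apply]
    have h1 : ∀ d : G.Dart, G.admmS.transpose i d * G.admmS d j =
        if d.fst = i then (if i = j then 1 else 0) else 0 := by
      intro d
      simp only [admmS, Matrix.transpose_apply, Matrix.of_apply]
      split_ifs <;> simp_all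
    simp only [h1, sum_dart_fst_const]
    by_cases hij : i = j
    · subst hij
      simp
    · simp [hij]
  have hinv : (G.admmS.transpose * G.admmS)⁻¹ = Matrix.diagonal fun i => (G.degree i : ℝ)⁻¹ := by
    refine Matrix.inv_eq_right_inv ?_
    rw [hS, Matrix.diagonal_mul_diagonal, ← Matrix.diagonal_one]
    congr 1
    ext i
    exact mul_inv_cancel₀ (hG.degree_real_pos i).ne'
  rw [admmB, hinv]
  ext d d'
  rw [Matrix.mul_apply]
  simp only [Matrix.mul_diagonal, admmS, Matrix.transpose_apply, Matrix.of_apply, dartAvg]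
  by_cases h : d'.fst = d.fst
  · simp [h]
  · simp [h, Ne.symm h]

/-- From `A + B - 2BA = 1/2 - (2B - 1)(A - 1/2)` and `A - 1/2 = (F + ρ/2) / (ρ + 2)`. -/
lemma Connected.admmMatrix_eq [Nontrivial V] (hG : G.Connected) {γ ρ : ℝ} (hρ : 0 < ρ) :
    G.admmMatrix γ ρ = G.dartOp ℝ (1 - γ / 2) (γ / (ρ + 2)) (ρ / 2) := by
  rw [admmMatrix, admmA_eq hρ, hG.admmB_eq, dartOp]
  have h2 : ρ + 2 ≠ 0 := by positivity
  rw [Matrix.mul_smul, mul_add, sub_mul, mul_add, Matrix.mul_smul, Matrix.mul_smul,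
    mul_one, mul_one, one_mul, Matrix.smul_mul]
  ext d d'
  simp only [Matrix.add_apply, Matrix.sub_apply, Matrix.smul_apply, smul_eq_mul]
  field_simp
  ring

lemma toComplex_dartOp (a c p : ℝ) : (G.dartOp ℝ a c p).toComplex = G.dartOp ℂ a c p := by
  have hsmul : ∀ (r : ℝ) (M : Matrix G.Dart G.Dart ℝ),
      (algebraMap ℝ ℂ).mapMatrix (r • M) = (r : ℂ) • (algebraMap ℝ ℂ).mapMatrix M := by
    intro r M
    ext
    simp
  have hF : (algebraMap ℝ ℂ).mapMatrix (G.dartFlip ℝ) = G.dartFlip ℂ := by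
    ext d d'
    simp [dartFlip, apply_ite]
  have hB : (algebraMap ℝ ℂ).mapMatrix (G.dartAvg ℝ) = G.dartAvg ℂ := by
    ext d d'
    by_cases h : d'.fst = d.fst <;> simp [dartAvg, h]
  show (algebraMap ℝ ℂ).mapMatrix _ = _
  rw [dartOp, dartOp, map_add, hsmul, hsmul, map_mul, map_sub, map_add, hsmul, hsmul, map_one, hF,
    hB]
  norm_num

lemma Connected.walkMatrix_toComplex_mulVec [Nontrivial V] (hG : G.Connected) (v : V → ℂ) :
    G.walkMatrix.toComplex *ᵥ v = G.walkAvg v := by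
  ext i
  rw [hG.walkMatrix_eq, walkAvg, neighborFinset_eq_filter, Finset.sum_filter, Finset.mul_sum]
  refine Finset.sum_congr rfl fun j _ => ?_
  show algebraMap ℝ ℂ ((Matrix.diagonal _ * G.adjMatrix ℝ : Matrix V V ℝ) i j) * v j = _
  rw [Matrix.diagonal_mul, adjMatrix_apply]
  split_ifs <;> simp

lemma Connected.walkMatrix_mulVec [Nontrivial V] (hG : G.Connected) (v : V → ℝ) :
    G.walkMatrix *ᵥ v = G.walkAvg v := by
  ext i
  rw [hG.walkMatrix_eq, walkAvg, ← Matrix.mulVec_mulVec, Matrix.mulVec_diagonal,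
    adjMatrix_mulVec_apply]

section Fixes

variable {a c p : ℝ}

lemma transpose_dartAvg : (G.dartAvg ℝ).transpose = G.dartAvg ℝ := by
  ext d d'
  simp only [dartAvg, Matrix.transpose_apply, Matrix.of_apply]
  by_cases h : d.fst = d'.fst
  · rw [h]
  · rw [if_neg h, if_neg (Ne.symm h)]

/-- The condition `hac` says that `u = 1 + p` corresponds to eigenvalue 1. For a fixed vector the
vertex averages are harmonic, hence constant, and they determine the vector because `(1 + 2 * p) ^ 2
≠ 1`. -/
lemma Connected.fixesConst_dartOp [Nontrivial V] (hG : G.Connected) (hc : c ≠ 0) (hp : 0 < p)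
    (hac : a + c * (1 + p) = 1) : (G.dartOp ℝ a c p).FixesConst 1 where
  right := by
    rw [dartOp_mulVec]
    ext d
    have h1 := outAvg_fst hG (fun _ => 1 + p) d.fst
    simp only [Pi.one_apply, mul_one]
    rw [h1]
    linear_combination hac
  left := by
    have hF : (1 : G.Dart → ℝ) ᵥ* G.dartFlip ℝ = 1 := by
      rw [← Matrix.mulVec_transpose, transpose_dartFlip, dartFlip_mulVec]
      rfl
    have hB : (1 : G.Dart → ℝ) ᵥ* G.dartAvg ℝ = 1 := by
      rw [← Matrix.mulVec_transpose, transpose_dartAvg, dartAvg_mulVec]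
      ext d
      exact outAvg_fst hG (fun _ => (1 : ℝ)) d.fst
    rw [dartOp, Matrix.vecMul_add, Matrix.vecMul_smul, Matrix.vecMul_one, Matrix.vecMul_smul,
      ← Matrix.vecMul_vecMul, Matrix.vecMul_sub, Matrix.vecMul_smul, hB, Matrix.vecMul_one,
      two_smul, add_sub_cancel_right, Matrix.vecMul_add, hF, Matrix.vecMul_smul, Matrix.vecMul_one]
    ext d
    simp only [Pi.add_apply, Pi.smul_apply, Pi.one_apply, smul_eq_mul, mul_one]
    exact hac
  ne := by
    obtain ⟨i⟩ := hG.nonempty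
    obtain ⟨j, hj⟩ := (G.degree_pos_iff_exists_adj i).1
      (hG.preconnected.degree_pos_of_nontrivial i)
    rw [one_dotProduct_one]
    exact_mod_cast (Fintype.card_pos_iff.2 ⟨(⟨(i, j), hj⟩ : G.Dart)⟩).ne'
  const x hx := by
    have h1 : ∀ d, 2 * G.outAvg (fun e => x e.symm + p * x e) d.fst - (x d.symm + p * x d) =
        (1 + p) * x d := by
      intro d
      have h2 := congrFun hx d
      rw [dartOp_mulVec] at h2
      refine mul_left_cancel₀ hc ?_
      linear_combination h2 - x d * hac
    obtain ⟨h2, h3⟩ := hG.walkAvg_outAvg h1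
    have h4 : G.walkMatrix *ᵥ G.outAvg x = G.outAvg x := by
      rw [hG.walkMatrix_mulVec]
      ext i
      refine mul_left_cancel₀ (b := G.walkAvg (G.outAvg x) i) (a := 2 * (1 + p)) (by positivity) ?_
      rw [h3]
      ring
    obtain ⟨k, hk⟩ := hG.fixesConst_walkMatrix.const _ h4
    refine ⟨k, ?_⟩
    ext d
    have h5 := h2 d
    simp only [hk, Pi.smul_apply, Pi.one_apply, smul_eq_mul, mul_one] at h5 ⊢
    refine mul_left_cancel₀ (a := (p + (1 + p)) ^ 2 - 1) ?_ ?_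
    · nlinarith
    · rw [h5]
      ring

end Fixes

section Eigenvalues

/-- If all vertex averages vanish, then `(p + u) ^ 2 = 1`. Otherwise they form an eigenvector of the
walk, whose spectrum is real, and `ω = 1` yields `u = 1 ± p`. The division by `u` fails only for `u
= 0`, which forces `p ^ 2 = 1` and is then one of the listed values. -/
lemma Connected.isEigval_dartOp_cases [Nontrivial V] (hG : G.Connected) {a c p : ℝ} (hc : c ≠ 0)
    {μ : ℂ} (hμ : (G.dartOp ℂ a c p).IsEigval μ) :
    ∃ u : ℂ, μ = a + c * u ∧ (u = 1 + p ∨ u = 1 - p ∨ u = -1 - p ∨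
      ∃ ω : ℝ, -1 ≤ ω ∧ ω ≤ G.omegaStar ∧ u ^ 2 - 2 * ω * u + 1 - p ^ 2 = 0) := by
  have hc' : (c : ℂ) ≠ 0 := by exact_mod_cast hc
  obtain ⟨x, hx, hT⟩ := hμ
  set u : ℂ := (μ - a) / c with hu
  have hμu : μ = a + c * u := by
    rw [hu, mul_div_cancel₀ _ hc']
    ring
  refine ⟨u, hμu, ?_⟩
  have h1 : ∀ d, 2 * G.outAvg (fun e => x e.symm + (p : ℂ) * x e) d.fst -
      (x d.symm + p * x d) = u * x d := by
    intro d
    have h2 := congrFun hT d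
    rw [dartOp_mulVec, hμu, Pi.smul_apply, smul_eq_mul] at h2
    refine mul_left_cancel₀ hc' ?_
    linear_combination h2
  obtain ⟨h2, h3⟩ := hG.walkAvg_outAvg h1
  by_cases hw : G.outAvg x = 0
  · obtain ⟨d, hd⟩ := Function.ne_iff.1 hx
    have h4 := h2 d
    simp only [hw, Pi.zero_apply, mul_zero, sub_zero] at h4
    have h5 := (mul_eq_zero.1 h4).resolve_right hd
    have h6 : ((p : ℂ) + u - 1) * (p + u + 1) = 0 := by linear_combination h5
    rcases mul_eq_zero.1 h6 with h | h
    · exact Or.inr (Or.inl (by linear_combination h))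
    · exact Or.inr (Or.inr (Or.inl (by linear_combination h)))
  obtain ⟨i, hi⟩ := Function.ne_iff.1 hw
  have hi : G.outAvg x i ≠ 0 := hi
  by_cases hu0 : u = 0
  · have h4 := h3 i
    rw [hu0] at h4 ⊢
    have h5 : (1 - (p : ℂ)) * (1 + p) = 0 := by
      have : ((1 - (p : ℂ)) * (1 + p)) * G.outAvg x i = 0 := by linear_combination -h4
      exact (mul_eq_zero.1 this).resolve_right hi
    rcases mul_eq_zero.1 h5 with h | h
    · exact Or.inr (Or.inl h.symm)
    · exact Or.inl h.symm
  set ω' : ℂ := (u ^ 2 - p ^ 2 + 1) / (2 * u) with hω'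
  have h2u : 2 * u ≠ 0 := mul_ne_zero two_ne_zero hu0
  have hquad : u ^ 2 - 2 * ω' * u + 1 - p ^ 2 = 0 := by
    have : 2 * u * ω' = u ^ 2 - p ^ 2 + 1 := by rw [hω', mul_div_cancel₀ _ h2u]
    linear_combination -this
  have hW : G.walkMatrix.toComplex.IsEigval ω' := by
    refine ⟨G.outAvg x, hw, ?_⟩
    rw [hG.walkMatrix_toComplex_mulVec]
    ext j
    refine mul_left_cancel₀ h2u ?_
    rw [h3, Pi.smul_apply, smul_eq_mul, ← mul_assoc, hω', mul_div_cancel₀ _ h2u]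
  obtain ⟨ω, hω, hWω⟩ := hW.exists_real hG.splits_charpoly_walkMatrix
  rw [hω] at hquad
  by_cases hω1 : ω = 1
  · have h6 : (u - 1 - p) * (u - 1 + p) = 0 := by
      rw [hω1] at hquad
      push_cast at hquad
      linear_combination hquad
    rcases mul_eq_zero.1 h6 with h | h
    · exact Or.inl (by linear_combination h)
    · exact Or.inr (Or.inl (by linear_combination h))
  · exact Or.inr (Or.inr (Or.inr ⟨ω, (abs_le.1 (hG.abs_le_one_of_isEigval hWω)).1,
      hG.omegaStar_spec.2.2 ω hWω hω1, hquad⟩))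

lemma Connected.isEigval_dartOp_omegaStar [Nontrivial V] (hG : G.Connected)
    (hω : G.omegaStar ^ 2 ≠ 1) {a c p : ℝ} {u : ℂ}
    (hu : u ^ 2 - 2 * G.omegaStar * u + 1 - p ^ 2 = 0) :
    (G.dartOp ℂ a c p).IsEigval (a + c * u) := by
  obtain ⟨v, hv0, hv⟩ := hG.omegaStar_spec.1.toComplex
  rw [hG.walkMatrix_toComplex_mulVec] at hv
  have hv' : ∀ i, G.walkAvg v i = G.omegaStar * v i := fun i => congrFun hv i
  exact ⟨_, hG.lift_ne_zero hv0 hv' (by exact_mod_cast hω) (p + u), hG.dartOp_lift hv' hu _ _⟩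

/-- The alternating vector is fixed by reversal and killed by averaging, so `u = -(1 + p)`. With the
ADMM coefficients this is the eigenvalue `1 - γ`, whatever `ρ` is. -/
lemma HasEvenCycle.isEigval_dartOp (h : G.HasEvenCycle) (a c p : ℝ) :
    (G.dartOp ℝ a c p).IsEigval (a - c * (1 + p)) := by
  obtain ⟨f, hf0, hf, hsum⟩ := h.exists_alternating
  refine ⟨f, hf0, ?_⟩
  rw [dartOp_mulVec]
  ext d
  have h1 : (fun e : G.Dart => f e.symm + p * f e) = fun e => (1 + p) * f e := by
    ext e
    rw [hf]
    ring
  rw [h1, outAvg_mul, outAvg, hsum, hf, Pi.smul_apply, smul_eq_mul]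
  ring

end Eigenvalues

end SimpleGraph

/-! ### The optimal rate of ADMM. -/

/-- Non-real roots are conjugate with product `b ^ 2`. For real `x > b` the quadratic is at least
`(x - b) ^ 2`, and for `x < -(1 + s)` at least `(x + 1) ^ 2 - s ^ 2`, both positive. -/
lemma norm_eq_or_real_of_quadratic {b s ω : ℝ} (hb : 0 ≤ b) (hs : 0 ≤ s) (hbs : s ^ 2 + b ^ 2 = 1)
    (hω1 : -1 ≤ ω) (hω2 : ω ≤ b) {u : ℂ} (hu : u ^ 2 - 2 * ω * u + b ^ 2 = 0) :
    ‖u‖ = b ∨ ∃ x : ℝ, u = x ∧ -(1 + s) ≤ x ∧ x ≤ b := by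
  have hre := congrArg Complex.re hu
  have him := congrArg Complex.im hu
  simp only [sq, Complex.add_re, Complex.sub_re, Complex.mul_re, Complex.mul_im, Complex.add_im,
    Complex.sub_im, Complex.ofReal_re, Complex.ofReal_im, Complex.re_ofNat, Complex.im_ofNat,
    Complex.zero_re, Complex.zero_im] at hre him
  ring_nf at hre him
  have h1 : u.im * (u.re - ω) = 0 := by linear_combination him / 2
  rcases mul_eq_zero.1 h1 with h | h
  · right
    rw [h] at hre
    refine ⟨u.re, Complex.ext rfl (by simpa using h), ?_, ?_⟩
    · by_contra hlt
      push Not at hlt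
      nlinarith
    · by_contra hlt
      push Not at hlt
      nlinarith
  · left
    have h2 : u.re = ω := by linarith
    rw [Complex.norm_def, Real.sqrt_eq_iff_mul_self_eq (Complex.normSq_nonneg u) hb,
      Complex.normSq_apply]
    rw [← h2] at hre
    linarith

lemma sqrt_sub_sq_ge {p s k : ℝ} (hs : 0 ≤ s) (hps : s ≤ p) (hk0 : 0 ≤ k) (hk1 : k ≤ 1) :
    k * (p - s) ≤ √(p ^ 2 - s ^ 2) := by
  have h0 : 0 ≤ p - s := sub_nonneg.2 hps
  refine Real.le_sqrt_of_sq_le ?_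
  have h1 : k ^ 2 ≤ 1 := by nlinarith
  have h2 : (k * (p - s)) ^ 2 ≤ (p - s) ^ 2 := by
    rw [mul_pow]
    exact mul_le_of_le_one_left (sq_nonneg _) h1
  nlinarith

namespace SimpleGraph

open Matrix

variable {V : Type*} [Fintype V] [DecidableEq V] {G : SimpleGraph V} [DecidableRel G.Adj]

/-- Every choice of the ADMM parameters has an eigenvalue which is at least as large as the
optimal rate. -/
lemma Connected.le_of_forall_isEigval_dartOp [Nontrivial V] (hG : G.Connected)
    (heven : G.HasEvenCycle) {s k γ p r : ℝ} (hs : 0 < s)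
    (hs2 : s ^ 2 + G.omegaStar ^ 2 = 1) (hk : k = G.omegaStar / (1 + s)) (hk0 : 0 ≤ k) (hk1 : k < 1)
    (hγ : 0 < γ) (hp : 0 < p)
    (hr : ∀ μ : ℂ, (G.dartOp ℂ ((1 - γ / 2 : ℝ) : ℂ) ((γ / (2 * (1 + p)) : ℝ) : ℂ) p).IsEigval μ →
      μ ≠ 1 → ‖μ‖ ≤ r) : (1 + k) / (3 - k) ≤ r := by
  set b := G.omegaStar with hb
  have hb1 : b < 1 := hG.omegaStar_spec.2.1
  have h3k : 0 < 3 - k := by linarith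
  have hbk : b = k * (1 + s) := by rw [hk, div_mul_cancel₀ _ (by positivity)]
  -- At this threshold `γ - 1` equals the claimed rate. For larger `γ` the even-cycle eigenvalue `1
  -- - γ` is too big; for smaller `γ` an eigenvalue coming from `ω*` is.
  by_cases hγ' : 4 / (3 - k) ≤ γ
  · have h1 := hr _ (by
      have := (heven.isEigval_dartOp (1 - γ / 2) (γ / (2 * (1 + p))) p).toComplex
      rwa [toComplex_dartOp] at this) (by
        have : 1 - γ / 2 - γ / (2 * (1 + p)) * (1 + p) ≠ 1 := by
          have : γ / (2 * (1 + p)) * (1 + p) = γ / 2 := by field_simp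
          rw [this]
          intro h
          linarith
        exact_mod_cast this)
    rw [Complex.norm_real, Real.norm_eq_abs] at h1
    have h2 : 1 - γ / 2 - γ / (2 * (1 + p)) * (1 + p) = 1 - γ := by
      field_simp
      ring
    rw [h2] at h1
    have h3 := (neg_abs_le (1 - γ)).trans' (neg_le_neg h1)
    have h4 : (1 + k) / (3 - k) = 4 / (3 - k) - 1 := by
      field_simp
      ring
    linarith
  push Not at hγ'
  have hτ : (1 + k) / (3 - k) = 1 - 4 / (3 - k) / 2 * (1 - k) := by
    field_simp
    ring
  have hlow : (1 + k) / (3 - k) ≤ 1 - γ / 2 * (1 - k) := by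
    rw [hτ]
    have : γ / 2 * (1 - k) ≤ 4 / (3 - k) / 2 * (1 - k) :=
      mul_le_mul_of_nonneg_right (by linarith) (by linarith)
    linarith
  have hb2 : b ^ 2 ≠ 1 := by nlinarith
  -- It suffices to find a root for `ω*` with real part in `[k * (1 + p), 1 + p)`: the real part of
  -- its eigenvalue is then at least `1 - γ / 2 * (1 - k)`.
  have key : ∀ x y : ℝ, ((x : ℂ) + y * Complex.I) ^ 2 - 2 * b * (x + y * Complex.I) + 1 - p ^ 2 = 0 →
      k * (1 + p) ≤ x → x < 1 + p → (1 + k) / (3 - k) ≤ r := by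
    intro x y hxy h1 h2
    have h3 := hG.isEigval_dartOp_omegaStar hb2 (a := 1 - γ / 2) (c := γ / (2 * (1 + p))) hxy
    have hc : 0 < γ / (2 * (1 + p)) := by positivity
    set μ : ℂ := ((1 - γ / 2 : ℝ) : ℂ) + ((γ / (2 * (1 + p)) : ℝ) : ℂ) * (x + y * Complex.I)
      with hμ
    have hre : μ.re = 1 - γ / 2 + γ / (2 * (1 + p)) * x := by
      rw [hμ, Complex.add_re, Complex.re_ofReal_mul, Complex.ofReal_re, Complex.add_re,
        Complex.ofReal_re, Complex.re_ofReal_mul, Complex.I_re, mul_zero, add_zero]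
    have hcp : γ / (2 * (1 + p)) * (1 + p) = γ / 2 := by field_simp
    have hne : μ ≠ 1 := by
      intro h
      rw [h, Complex.one_re] at hre
      have := mul_lt_mul_of_pos_left h2 hc
      linarith
    have h4 := hr μ h3 hne
    have h5 := (Complex.re_le_norm μ).trans h4
    have h6 := mul_le_mul_of_nonneg_left h1 hc.le
    rw [hre] at h5
    have h7 : γ / (2 * (1 + p)) * (k * (1 + p)) = γ / 2 * k := by rw [← hcp]; ring
    linarith
  -- The roots are `b ± √(p ^ 2 - s ^ 2)`: real for `p ≥ s`, and of real part `b = k * (1 + s)` for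
  -- `p ≤ s`.
  rcases le_total s p with hsp | hsp
  · have hsq : √(p ^ 2 - s ^ 2) ^ 2 = p ^ 2 - s ^ 2 := Real.sq_sqrt (by nlinarith)
    have hsqC : ((√(p ^ 2 - s ^ 2) : ℝ) : ℂ) ^ 2 = (p : ℂ) ^ 2 - s ^ 2 := by exact_mod_cast hsq
    have hsC : (s : ℂ) ^ 2 + b ^ 2 = 1 := by exact_mod_cast hs2
    refine key (b + √(p ^ 2 - s ^ 2)) 0 ?_ ?_ ?_
    · push_cast
      linear_combination hsqC - hsC
    · have := sqrt_sub_sq_ge hs.le hsp hk0 hk1.le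
      rw [hbk]
      linarith
    · have : √(p ^ 2 - s ^ 2) ≤ p := Real.sqrt_le_iff.2 ⟨hp.le, by nlinarith⟩
      linarith
  · have hsq : √(s ^ 2 - p ^ 2) ^ 2 = s ^ 2 - p ^ 2 := Real.sq_sqrt (by nlinarith)
    have hsqC : ((√(s ^ 2 - p ^ 2) : ℝ) : ℂ) ^ 2 = (s : ℂ) ^ 2 - p ^ 2 := by exact_mod_cast hsq
    have hsC : (s : ℂ) ^ 2 + b ^ 2 = 1 := by exact_mod_cast hs2
    refine key b √(s ^ 2 - p ^ 2) ?_ ?_ ?_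
    · linear_combination -hsqC - hsC + ((√(s ^ 2 - p ^ 2) : ℝ) : ℂ) ^ 2 * Complex.I_sq
    · rw [hbk]
      exact mul_le_mul_of_nonneg_left (by linarith) hk0
    · linarith

/-- At `ρ = 2 * s` the roots for `ω*` merge at `ω*`. At `γ = 4 / (3 - k)` the interval `[-(1 + s),
ω*]` of real values of `u` is mapped onto `[-τ, τ]`, so both ends are extremal. -/
lemma Connected.isOptimalADMMRate [Nontrivial V] (hG : G.Connected) (heven : G.HasEvenCycle)
    (hω : 0 ≤ G.omegaStar) {s k : ℝ} (hs : 0 < s) (hs2 : s ^ 2 + G.omegaStar ^ 2 = 1)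
    (hk : k = G.omegaStar / (1 + s)) : G.IsOptimalADMMRate ((1 + k) / (3 - k)) := by
  have hb1 : G.omegaStar < 1 := hG.omegaStar_spec.2.1
  have hk0 : 0 ≤ k := hk ▸ div_nonneg hω (by positivity)
  have hk1 : k < 1 := by
    rw [hk, div_lt_one (by positivity)]
    linarith
  have h3k : 0 < 3 - k := by linarith
  set τ := (1 + k) / (3 - k) with hτ
  have hτ0 : 0 ≤ τ := by positivity
  have hτ1 : τ < 1 := by
    rw [hτ, div_lt_one h3k]
    linarith
  have hT : ∀ γ ρ : ℝ, 0 < ρ → G.admmMatrix γ ρ =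
      G.dartOp ℝ (1 - γ / 2) (γ / (2 * (1 + ρ / 2))) (ρ / 2) := by
    intro γ ρ hρ
    rw [hG.admmMatrix_eq hρ]
    congr 2
    ring
  have hTC : ∀ γ ρ : ℝ, 0 < ρ → (G.admmMatrix γ ρ).toComplex =
      G.dartOp ℂ ((1 - γ / 2 : ℝ) : ℂ) ((γ / (2 * (1 + ρ / 2)) : ℝ) : ℂ) ((ρ / 2 : ℝ) : ℂ) := by
    intro γ ρ hρ
    rw [hT γ ρ hρ, toComplex_dartOp]
  have hF : ∀ γ ρ : ℝ, 0 < γ → 0 < ρ → (G.admmMatrix γ ρ).FixesConst 1 := by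
    intro γ ρ hγ hρ
    rw [hT γ ρ hρ]
    refine hG.fixesConst_dartOp (by positivity) (by positivity) ?_
    field_simp
    ring
  have hlow : ∀ γ ρ : ℝ, 0 < γ → 0 < ρ → ∀ r : ℝ,
      (∀ μ : ℂ, (G.admmMatrix γ ρ).toComplex.IsEigval μ → μ ≠ 1 → ‖μ‖ ≤ r) → τ ≤ r := by
    intro γ ρ hγ hρ r hr
    rw [hTC γ ρ hρ] at hr
    exact hG.le_of_forall_isEigval_dartOp heven hs hs2 hk hk0 hk1 hγ (by positivity) hr
  set γ : ℝ := 4 / (3 - k) with hγ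
  have hγ0 : 0 < γ := by positivity
  have hγ2 : γ < 2 := by
    rw [hγ, div_lt_iff₀ h3k]
    linarith
  have hγτ : τ = γ - 1 := by
    rw [hτ, hγ]
    field_simp
    ring
  have hγk : 1 - γ / 2 + γ / 2 * k = τ := by
    rw [hτ, hγ]
    field_simp
    ring
  have hρ0 : 0 < 2 * s := by positivity
  have hs' : 2 * s / 2 = s := by ring
  have hbk : G.omegaStar = k * (1 + s) := by rw [hk, div_mul_cancel₀ _ (by positivity)]
  set c : ℝ := γ / (2 * (1 + s)) with hc
  have hc0 : 0 < c := by positivity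
  have hcs : c * (1 + s) = γ / 2 := by rw [hc]; field_simp
  have hcb : c * G.omegaStar = γ / 2 * k := by rw [hbk, ← hcs]; ring
  have hreal : ∀ x : ℝ, -(1 + s) ≤ x → x ≤ G.omegaStar →
      ‖((1 - γ / 2 : ℝ) : ℂ) + (c : ℂ) * (x : ℂ)‖ ≤ τ := by
    intro x h1 h2
    rw [← Complex.ofReal_mul, ← Complex.ofReal_add, Complex.norm_real, Real.norm_eq_abs, abs_le]
    have h3 := mul_le_mul_of_nonneg_left h1 hc0.le
    have h4 := mul_le_mul_of_nonneg_left h2 hc0.le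
    constructor
    · linarith
    · linarith
  have hle : ∀ μ : ℂ, (G.admmMatrix γ (2 * s)).toComplex.IsEigval μ → μ ≠ 1 → ‖μ‖ ≤ τ := by
    intro μ hμ hμ1
    rw [hTC _ _ hρ0, hs', ← hc] at hμ
    obtain ⟨u, rfl, hu | hu | hu | ⟨ω, hω1, hω2, hu⟩⟩ := hG.isEigval_dartOp_cases hc0.ne' hμ
    · refine absurd ?_ hμ1
      have : 1 - γ / 2 + c * (1 + s) = 1 := by rw [hcs]; ring
      rw [hu]
      exact_mod_cast this
    · have h1 := hreal (1 - s) (by linarith) (by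
        by_contra hlt
        push Not at hlt
        nlinarith)
      rw [hu]
      simpa using h1
    · have h1 := hreal (-1 - s) (by linarith) (by linarith)
      rw [hu]
      simpa using h1
    · have hu' : u ^ 2 - 2 * ω * u + (G.omegaStar : ℂ) ^ 2 = 0 := by
        have : (s : ℂ) ^ 2 + G.omegaStar ^ 2 = 1 := by exact_mod_cast hs2
        linear_combination hu + this
      rcases norm_eq_or_real_of_quadratic hω hs.le hs2 hω1 hω2 hu' with h | ⟨x, rfl, h1, h2⟩
      -- Non-real roots have modulus `ω*`, so the triangle inequality gives the same bound as the
      -- real root `ω*`.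
      · refine (norm_add_le _ _).trans ?_
        rw [norm_mul, h, Complex.norm_real, Complex.norm_real, Real.norm_of_nonneg hc0.le,
          Real.norm_of_nonneg (by linarith), hcb, hγk]
      · exact hreal x h1 h2
  have hex : ∃ μ : ℂ, (G.admmMatrix γ (2 * s)).toComplex.IsEigval μ ∧ μ ≠ 1 ∧ ‖μ‖ = τ := by
    have h1 := (heven.isEigval_dartOp (1 - γ / 2) c s).toComplex
    have h2 : 1 - γ / 2 - c * (1 + s) = -τ := by rw [hcs, hγτ]; ring
    rw [toComplex_dartOp, h2] at h1
    refine ⟨_, by rw [hTC _ _ hρ0, hs', ← hc]; exact h1, ?_, ?_⟩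
    · have : -τ ≠ 1 := by linarith
      exact_mod_cast this
    · rw [Complex.norm_real, norm_neg, Real.norm_of_nonneg hτ0]
  have hFo := hF γ (2 * s) hγ0 hρ0
  refine ⟨⟨⟨γ, 2 * s, hγ0, hγ2, hρ0, hFo.isConvergenceRate hle hex hτ1⟩, ?_⟩,
    ⟨⟨γ, 2 * s, hγ0, hγ2, hρ0, (hFo.absLambdaTwo_eq hle hex hτ1.le).symm⟩, ?_⟩⟩
  · rintro r ⟨γ', ρ, hγ', -, hρ, hr⟩
    exact hlow γ' ρ hγ' hρ r fun μ hμ hμ1 => hr.norm_le hμ hμ1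
  · rintro r ⟨γ', ρ, hγ', -, hρ, rfl⟩
    by_contra hlt
    push Not at hlt
    refine absurd (hlow γ' ρ hγ' hρ _ fun μ hμ hμ1 => ?_) (not_le.2 hlt)
    rcases min_le_iff.1 ((hF γ' ρ hγ' hρ).min_le_absLambdaTwo hμ hμ1) with h | h
    · linarith
    · exact h

end SimpleGraph

/-! ### The comparison factor and the main theorem. -/

/-- The factor comparing the rates of gradient descent and ADMM, in terms of the spectral gap. -/
noncomputable def rateFactor (δ : ℝ) : ℝ :=
  4 * (1 + δ) * (1 + √(δ * (2 - δ))) / (2 + 3 * √(δ * (2 - δ)) + δ) ^ 2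

lemma rateFactor_pos {δ : ℝ} (h0 : 0 < δ) : 0 < rateFactor δ := by
  unfold rateFactor
  positivity

lemma abs_rateFactor_sub_one_le {δ : ℝ} (h0 : 0 < δ) (h1 : δ ≤ 1) :
    |rateFactor δ - 1| ≤ 15 * √δ := by
  set q := √δ with hq
  set s := √(δ * (2 - δ)) with hs
  have hq0 : 0 ≤ q := Real.sqrt_nonneg _
  have hqδ : q ^ 2 = δ := Real.sq_sqrt h0.le
  have hq1 : q ≤ 1 := Real.sqrt_le_one.2 h1
  have hs0 : 0 ≤ s := Real.sqrt_nonneg _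
  have hsq : s ≤ 2 * q := by
    refine Real.sqrt_le_iff.2 ⟨by positivity, ?_⟩
    rw [mul_pow, hqδ]
    nlinarith
  have hD : 4 ≤ (2 + 3 * s + δ) ^ 2 := by nlinarith
  have hDpos : 0 < (2 + 3 * s + δ) ^ 2 := by positivity
  have h2 : rateFactor δ - 1 =
      -((8 * s + 2 * δ * s + 9 * s ^ 2 + δ ^ 2) / (2 + 3 * s + δ) ^ 2) := by
    rw [rateFactor, ← hs]
    field_simp
    ring
  -- The numerator is at most `(16 + 4 + 36 + 1) * q = 57 * q` and the denominator at least 4,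
  -- whence the constant 15.
  rw [h2, abs_neg, abs_of_nonneg (by positivity), div_le_iff₀ hDpos]
  have hδq : δ ≤ q := by nlinarith
  have h3 : δ * s ≤ 2 * q := by nlinarith
  have h4 : s ^ 2 ≤ 4 * q := by nlinarith
  have h5 : δ ^ 2 ≤ q := by nlinarith
  have h6 : 15 * q * 4 ≤ 15 * q * (2 + 3 * s + δ) ^ 2 :=
    mul_le_mul_of_nonneg_left hD (by positivity)
  linarith

/-- Here `1 - τA = 2 * (s + δ) / (2 + 3 * s + δ)` with `δ = 1 - ω`, and `(s + δ) ^ 2 = 2 * δ * (1 +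
s)` because `s ^ 2 = δ * (2 - δ)`. -/
lemma sq_one_sub_rate_eq {ω s : ℝ} (hω : 0 ≤ ω) (hω1 : ω < 1)
    (hs : s = √((1 - ω) * (2 - (1 - ω)))) :
    (1 - (1 + ω / (1 + s)) / (3 - ω / (1 + s))) ^ 2 * (1 + (1 - ω)) =
      2 * (1 - ω) * rateFactor (1 - ω) := by
  have hs0 : 0 ≤ s := hs ▸ Real.sqrt_nonneg _
  have hs2 : s ^ 2 = (1 - ω) * (2 - (1 - ω)) := by
    rw [hs]
    exact Real.sq_sqrt (mul_nonneg (by linarith) (by linarith))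
  obtain ⟨D, hD⟩ : ∃ D, D = 2 + 3 * s + (1 - ω) := ⟨_, rfl⟩
  have hD0 : 0 < D := by linarith
  have h1 : 3 - ω / (1 + s) = D / (1 + s) := by
    rw [hD]
    field_simp
    ring
  have h2 : 1 - (1 + ω / (1 + s)) / (3 - ω / (1 + s)) = 2 * (s + (1 - ω)) / D := by
    rw [h1]
    field_simp
    linear_combination hD
  rw [h2, rateFactor, ← hs, ← hD, div_pow]
  field_simp
  linear_combination 2 * (1 + (1 - ω)) * hs2

theorem mainTheorem2 :
    ∃ (C : ℝ → ℝ) (K : ℝ),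
      (∀ δ : ℝ, 0 < δ → δ ≤ 1 → 0 < C δ ∧ |C δ - 1| ≤ K * √δ) ∧
      ∀ (V : Type*) [Fintype V] [DecidableEq V] (G : SimpleGraph V) [DecidableRel G.Adj],
        G.Connected → G.HasEvenCycle → G.conductance ≤ 1 / 2 →
          (0 < 1 - G.omegaStar ∧ 1 - G.omegaStar ≤ 1) ∧
          ∃ τG τA : ℝ, G.IsOptimalGDRate τG ∧ G.IsOptimalADMMRate τA ∧
            C (1 - G.omegaStar) * (1 - τG) ≤ (1 - τA) ^ 2 ∧
            (1 - τA) ^ 2 ≤ 2 * G.degreeRatio * C (1 - G.omegaStar) * (1 - τG) := by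
  refine ⟨rateFactor, 15, fun δ h0 h1 => ⟨rateFactor_pos h0, abs_rateFactor_sub_one_le h0 h1⟩, ?_⟩
  intro V _ _ G _ hG heven hΦ
  have := heven.nontrivial
  have hω1 : G.omegaStar < 1 := hG.omegaStar_spec.2.1
  have hgap := hG.gap_le_two_mul_conductance
  have hω0 : 0 ≤ G.omegaStar := by linarith
  refine ⟨⟨by linarith, by linarith⟩, ?_⟩
  obtain ⟨l, m, hl0, hlm, hl, hm, hlm'⟩ := hG.exists_lapMatrix_extreme
  set δ := 1 - G.omegaStar with hδ
  have hδ0 : 0 < δ := by linarith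
  set s := √(δ * (2 - δ)) with hs
  have hs0 : 0 < s := Real.sqrt_pos.2 (mul_pos hδ0 (by linarith))
  have hs2 : s ^ 2 + G.omegaStar ^ 2 = 1 := by
    rw [hs, Real.sq_sqrt (mul_pos hδ0 (by linarith)).le, hδ]
    ring
  refine ⟨_, _, hG.isOptimalGDRate hl0 hlm hl hm hlm',
    hG.isOptimalADMMRate heven hω0 hs0 hs2 rfl, ?_⟩
  have hA := sq_one_sub_rate_eq hω0 hω1 (s := s) (by rw [hs, hδ])
  rw [← hδ] at hA
  set τA := (1 + G.omegaStar / (1 + s)) / (3 - G.omegaStar / (1 + s))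
  set C := rateFactor δ
  have hC : 0 < C := rateFactor_pos hδ0
  have hml : 0 < m + l := by linarith
  have hGD : 1 - (m - l) / (m + l) = 2 * l / (m + l) := by
    field_simp
    ring
  have hτA : (1 - τA) ^ 2 = 2 * δ * C / (1 + δ) := by
    rw [eq_div_iff (by positivity)]
    exact hA
  have hd : (0 : ℝ) < G.minDegree := by
    obtain ⟨i, hi⟩ := G.exists_minimal_degree_vertex
    rw [hi]
    exact hG.degree_real_pos i
  have hM : (G.maxDegree : ℝ) ≤ m :=
    SimpleGraph.maxDegree_le_of_eigval_le (by linarith) fun μ hμ hμ0 => (hlm' μ hμ hμ0).2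
  have hm2 : m ≤ 2 * G.maxDegree :=
    SimpleGraph.lapMatrix_eigval_le hm
  have hdl : (G.minDegree : ℝ) * δ ≤ l := hG.minDegree_mul_gap_le hl0 hl
  have hlM : l ≤ G.maxDegree * δ := hG.le_maxDegree_mul_gap fun μ hμ hμ0 => (hlm' μ hμ hμ0).1
  have hΔ1 : 1 ≤ G.degreeRatio := by
    rw [SimpleGraph.degreeRatio, one_le_div hd]
    obtain ⟨i⟩ := hG.nonempty
    exact_mod_cast (G.minDegree_le_degree i).trans (G.degree_le_maxDegree i)
  have hΔ : (G.maxDegree : ℝ) = G.degreeRatio * G.minDegree := by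
    rw [SimpleGraph.degreeRatio, div_mul_cancel₀ _ hd.ne']
  rw [hGD, hτA]
  constructor
  -- Equivalent to `l ≤ δ * m`, which follows from `l ≤ d_max * δ` and `d_max ≤ m`.
  · have h1 : l * (1 + δ) ≤ δ * (m + l) := by
      have := mul_le_mul_of_nonneg_right hM hδ0.le
      linarith
    rw [← mul_div_assoc, div_le_div_iff₀ hml (by positivity)]
    have := mul_le_mul_of_nonneg_left h1 (by positivity : 0 ≤ 2 * C)
    linarith
  -- Use `δ * m ≤ 2 * d_max * δ = 2 * Δ * d_min * δ ≤ 2 * Δ * l`, and absorb `δ * l` by `Δ ≥ 1`.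
  · have h1 : δ * (m + l) ≤ 2 * G.degreeRatio * (l * (1 + δ)) := by
      have h2 := mul_le_mul_of_nonneg_left hdl (by linarith : 0 ≤ G.degreeRatio)
      rw [← mul_assoc, ← hΔ] at h2
      have h3 := mul_le_mul_of_nonneg_right hm2 hδ0.le
      have h4 := mul_le_mul_of_nonneg_right hΔ1 (mul_pos hl0 hδ0).le
      have h5 := mul_pos hl0 hδ0
      linarith
    rw [← mul_div_assoc, div_le_div_iff₀ (by positivity) hml]
    have := mul_le_mul_of_nonneg_left h1 (by positivity : 0 ≤ 2 * C)
    linarith
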